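/- Let $\mathcal V$ be an arbitrary set of variables (possibly infinite, finite or empty). Formulae are built from the atoms $x\leq y$ ($x,y\in\mathcal V$) and $\top$ with a binary connective $\wedge$. Let $M_\leq$ be the category whose objects are formulae and whose arrows are equivalence classes of arrow terms. Arrow terms are generated under $f\wedge g$ and typed composition $g\circ f$ by $$\mathbf 1_A:A\vdash A,\quad b^{\rightarrow}_{A,B,C}:A\wedge(B\wedge C)\vdash(A\wedge B)\wedge C,\quad b^{\leftarrow}_{A,B,C}:(A\wedge B)\wedge C\vdash A\wedge(B\wedge C),$$ $$\delta^{\rightarrow}_A:A\wedge\top\vdash A,\quad \delta^{\leftarrow}_A:A\vdash A\wedge\top,\quad \sigma^{\rightarrow}_A:\top\wedge A\vdash A,\quad \sigma^{\leftarrow}_A:A\vdash\top\wedge A,$$ $$r_x:\top\vdash x\leq x,\qquad t_{x,y,z}:(x\leq y)\wedge(y\leq z)\vdash x\leq z .$$ Two arrow terms are equal in $M_\leq$ when they are identified by the smallest congruence (for $\wedge$ and $\circ$) that contains the equations of a monoidal category (the category laws, bifunctoriality of $\wedge$, naturality of $b,\delta,\sigma$, the fact that $b^{\rightarrow},\delta^{\rightarrow},\sigma^{\rightarrow}$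 are inverse to $b^{\leftarrow},\delta^{\leftarrow},\sigma^{\leftarrow}$, the pentagon and the triangle), and $$(rt\delta)\quad t_{x,y,y}\circ(\mathbf 1_{x\leq y}\wedge r_y)=\delta^{\rightarrow}_{x\leq y},\qquad (rt\sigma)\quad t_{y,y,x}\circ(r_y\wedge\mathbf 1_{y\leq x})=\sigma^{\rightarrow}_{y\leq x},$$ $$(tb)\quad t_{x,y,u}\circ(\mathbf 1_{x\leq y}\wedge t_{y,z,u})=t_{x,z,u}\circ(t_{x,y,z}\wedge\mathbf 1_{z\leq u})\circ b^{\rightarrow}_{x\leq y,\,y\leq z,\,z\leq u}.$$ Let $\mathit{Br}$ be the category whose objects are the natural numbers (finite ordinals) and whose arrows $n\to m$ are the equivalence relations on the disjoint union of $n$ source points and $m$ target points all of whose classes have exactly two elements. Composition stacks two such relations along the common middle points, takes the generated equivalence relation, and restricts it to the outer points. Let $G:M_\leq\to\mathit{Br}$ be the functor that sends a formula $A$ to the number of occurrences of variables in $A$, sends $\mathbf 1,b^{\rightarrow},b^{\leftarrow},\delta^{\rightarrow},\delta^{\leftarrow},\sigma^{\rightarrow},\sigma^{\leftarrow}$ to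 diagrams of parallel lines, sends $r_x$ to the cap that joins the two target points, sends $t_{x,y,z}$ to the diagram that joins the second and third source points, the first source point with the first target point, and the fourth source point with the second target point, and sends $\wedge$ on arrows to horizontal juxtaposition. Then $G$ is faithful: for arrows $f,g:A\vdash B$ of $M_\leq$, $f=g$ in $M_\leq$ if and only if $Gf=Gg$. The corresponding functor to $\mathit{Br}$ is also faithful for the category defined like $M_\leq$ but without the arrows $r_x$ and the equations $(rt\delta)$ and $(rt\sigma)$, and for the category defined like $M_\leq$ but without the arrows $t_{x,y,z}$ and the equations $(rt\delta)$, $(rt\sigma)$ and $(tb)$. -/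

import Mathlib

open CategoryTheory

namespace LinearEquality

universe u

/-! ### Formulae, arrow terms and their equality -/

/-- Formulae over a set `𝒱` of variables: the atoms are `x ≤ y` and `⊤`, and formulae are closed
under the binary connective `∧`. -/
inductive Formula (𝒱 : Type u) : Type u
  | leq (x y : 𝒱) : Formula 𝒱
  | top : Formula 𝒱
  | and (A B : Formula 𝒱) : Formula 𝒱

/-- The three systems under consideration: the full system `M_≤`, the one without the arrows
`r_x`, and the one without the arrows `t_{x,y,z}`. -/
inductive Variant
  | full
  | withoutR
  | withoutT

/-- The arrows `r_x` are present. -/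
def Variant.HasR : Variant → Prop
  | full => True
  | withoutR => False
  | withoutT => True

/-- The arrows `t_{x,y,z}` are present. -/
def Variant.HasT : Variant → Prop
  | full => True
  | withoutR => True
  | withoutT => False

scoped infix:70 " ≼ " => Formula.leq
scoped infixr:65 " ⋏ " => Formula.and

open Formula (top)

/-- Arrow terms `f : A ⊢ B`. -/
inductive ArrowTerm (𝒱 : Type u) (s : Variant) : Formula 𝒱 → Formula 𝒱 → Type u
  | one (A : Formula 𝒱) : ArrowTerm 𝒱 s A A
  | bTo (A B C : Formula 𝒱) : ArrowTerm 𝒱 s (A ⋏ (B ⋏ C)) ((A ⋏ B) ⋏ C)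
  | bFrom (A B C : Formula 𝒱) : ArrowTerm 𝒱 s ((A ⋏ B) ⋏ C) (A ⋏ (B ⋏ C))
  | dTo (A : Formula 𝒱) : ArrowTerm 𝒱 s (A ⋏ top) A
  | dFrom (A : Formula 𝒱) : ArrowTerm 𝒱 s A (A ⋏ top)
  | sTo (A : Formula 𝒱) : ArrowTerm 𝒱 s (top ⋏ A) A
  | sFrom (A : Formula 𝒱) : ArrowTerm 𝒱 s A (top ⋏ A)
  | r (hr : s.HasR) (x : 𝒱) : ArrowTerm 𝒱 s top (x ≼ x)
  | t (ht : s.HasT) (x y z : 𝒱) : ArrowTerm 𝒱 s ((x ≼ y) ⋏ (y ≼ z)) (x ≼ z)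
  | wedge {A B C D : Formula 𝒱} (f : ArrowTerm 𝒱 s A B) (g : ArrowTerm 𝒱 s C D) :
      ArrowTerm 𝒱 s (A ⋏ C) (B ⋏ D)
  | comp {A B C : Formula 𝒱} (g : ArrowTerm 𝒱 s B C) (f : ArrowTerm 𝒱 s A B) :
      ArrowTerm 𝒱 s A C

scoped infixr:80 " ⊚ " => ArrowTerm.comp
scoped infixr:85 " ⩓ " => ArrowTerm.wedge

open ArrowTerm

/-- Equality of arrow terms: the smallest congruence containing the categorial, bifunctoriality
and naturality equations, the specific equations of monoidal categories, and the equations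
`(rtδ)`, `(rtσ)`, `(tb)` (those among them whose arrow terms are present). -/
inductive TermEq {𝒱 : Type u} {s : Variant} :
    ∀ {A B : Formula 𝒱}, ArrowTerm 𝒱 s A B → ArrowTerm 𝒱 s A B → Prop
  | refl {A B : Formula 𝒱} (f : ArrowTerm 𝒱 s A B) : TermEq f f
  | symm {A B : Formula 𝒱} {f g : ArrowTerm 𝒱 s A B} : TermEq f g → TermEq g f
  | trans {A B : Formula 𝒱} {f g h : ArrowTerm 𝒱 s A B} : TermEq f g → TermEq g h → TermEq f h
  | congr_wedge {A B C D : Formula 𝒱} {f₁ g₁ : ArrowTerm 𝒱 s A B} {f₂ g₂ : ArrowTerm 𝒱 s C D} :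
      TermEq f₁ g₁ → TermEq f₂ g₂ → TermEq (f₁ ⩓ f₂) (g₁ ⩓ g₂)
  | congr_comp {A B C : Formula 𝒱} {f₁ g₁ : ArrowTerm 𝒱 s A B} {f₂ g₂ : ArrowTerm 𝒱 s B C} :
      TermEq f₁ g₁ → TermEq f₂ g₂ → TermEq (f₂ ⊚ f₁) (g₂ ⊚ g₁)
  -- categorial equations
  | cat1_left {A B : Formula 𝒱} (f : ArrowTerm 𝒱 s A B) : TermEq (one B ⊚ f) f
  | cat1_right {A B : Formula 𝒱} (f : ArrowTerm 𝒱 s A B) : TermEq (f ⊚ one A) f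
  | cat2 {A B C D : Formula 𝒱} (h : ArrowTerm 𝒱 s C D) (g : ArrowTerm 𝒱 s B C)
      (f : ArrowTerm 𝒱 s A B) : TermEq ((h ⊚ g) ⊚ f) (h ⊚ (g ⊚ f))
  -- bifunctoriality equations
  | wedge1 (A B : Formula 𝒱) : TermEq (one A ⩓ one B) (one (A ⋏ B))
  | wedge2 {A₁ B₁ C₁ A₂ B₂ C₂ : Formula 𝒱}
      (g₁ : ArrowTerm 𝒱 s B₁ C₁) (f₁ : ArrowTerm 𝒱 s A₁ B₁)
      (g₂ : ArrowTerm 𝒱 s B₂ C₂) (f₂ : ArrowTerm 𝒱 s A₂ B₂) :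
      TermEq ((g₁ ⊚ f₁) ⩓ (g₂ ⊚ f₂)) ((g₁ ⩓ g₂) ⊚ (f₁ ⩓ f₂))
  -- naturality equations
  | b_nat {A B C D E F : Formula 𝒱}
      (f : ArrowTerm 𝒱 s A D) (g : ArrowTerm 𝒱 s B E) (h : ArrowTerm 𝒱 s C F) :
      TermEq (((f ⩓ g) ⩓ h) ⊚ bTo A B C) (bTo D E F ⊚ (f ⩓ (g ⩓ h)))
  | d_nat {A D : Formula 𝒱} (f : ArrowTerm 𝒱 s A D) :
      TermEq (f ⊚ dTo A) (dTo D ⊚ (f ⩓ one top))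
  | s_nat {A D : Formula 𝒱} (f : ArrowTerm 𝒱 s A D) :
      TermEq (f ⊚ sTo A) (sTo D ⊚ (one top ⩓ f))
  -- specific equations of monoidal categories
  | bb_left (A B C : Formula 𝒱) : TermEq (bFrom A B C ⊚ bTo A B C) (one (A ⋏ (B ⋏ C)))
  | bb_right (A B C : Formula 𝒱) : TermEq (bTo A B C ⊚ bFrom A B C) (one ((A ⋏ B) ⋏ C))
  | b5 (A B C D : Formula 𝒱) :
      TermEq (bTo (A ⋏ B) C D ⊚ bTo A B (C ⋏ D))
        ((bTo A B C ⩓ one D) ⊚ (bTo A (B ⋏ C) D ⊚ (one A ⩓ bTo B C D)))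
  | dd_left (A : Formula 𝒱) : TermEq (dFrom A ⊚ dTo A) (one (A ⋏ top))
  | dd_right (A : Formula 𝒱) : TermEq (dTo A ⊚ dFrom A) (one A)
  | ss_left (A : Formula 𝒱) : TermEq (sFrom A ⊚ sTo A) (one (top ⋏ A))
  | ss_right (A : Formula 𝒱) : TermEq (sTo A ⊚ sFrom A) (one A)
  | bds (A C : Formula 𝒱) :
      TermEq (bTo A top C) ((dFrom A ⩓ one C) ⊚ (one A ⩓ sTo C))
  -- equations for `r` and `t`
  | rtd (hr : s.HasR) (ht : s.HasT) (x y : 𝒱) :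
      TermEq (t ht x y y ⊚ (one (x ≼ y) ⩓ r hr y)) (dTo (x ≼ y))
  | rts (hr : s.HasR) (ht : s.HasT) (x y : 𝒱) :
      TermEq (t ht y y x ⊚ (r hr y ⩓ one (y ≼ x))) (sTo (y ≼ x))
  | tb (ht : s.HasT) (x y z u : 𝒱) :
      TermEq (t ht x y u ⊚ (one (x ≼ y) ⩓ t ht y z u))
        (t ht x z u ⊚ ((t ht x y z ⩓ one (z ≼ u)) ⊚ bTo (x ≼ y) (y ≼ z) (z ≼ u)))

instance termSetoid (𝒱 : Type u) (s : Variant) (A B : Formula 𝒱) :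
    Setoid (ArrowTerm 𝒱 s A B) :=
  ⟨TermEq, ⟨TermEq.refl, TermEq.symm, TermEq.trans⟩⟩

/-- The category `M_≤` (for `s = full`) and its two variants: objects are formulae, arrows are
arrow terms modulo equality. -/
structure M (𝒱 : Type u) (s : Variant) : Type u where
  formula : Formula 𝒱

instance (𝒱 : Type u) (s : Variant) : Category.{u} (M 𝒱 s) where
  Hom A B := Quotient (termSetoid 𝒱 s A.formula B.formula)
  id A := ⟦one A.formula⟧
  comp := Quotient.map₂ (fun f g => g ⊚ f) (fun _ _ hf _ _ hg => TermEq.congr_comp hf hg)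
  id_comp := by
    rintro A B ⟨f⟩
    exact Quotient.sound (TermEq.cat1_right f)
  comp_id := by
    rintro A B ⟨f⟩
    exact Quotient.sound (TermEq.cat1_left f)
  assoc := by
    rintro A B C D ⟨f⟩ ⟨g⟩ ⟨h⟩
    exact Quotient.sound (TermEq.symm (TermEq.cat2 h g f))

/-- The arrow of `M_≤` (or of one of its variants) named by an arrow term. -/
def ArrowTerm.toHom {𝒱 : Type u} {s : Variant} {A B : Formula 𝒱} (f : ArrowTerm 𝒱 s A B) :
    (⟨A⟩ : M 𝒱 s) ⟶ ⟨B⟩ :=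
  Quotient.mk (termSetoid 𝒱 s A B) f

/-! ### The category `Br` of Brauer diagrams -/

/-- Every equivalence class has exactly two elements. -/
def IsBrauer {X : Type*} (r : Setoid X) : Prop := ∀ a, ∃! b, b ≠ a ∧ r a b

section Composition

variable {X Y Z : Type}

/-- Two diagrams `P` (from `X` to `Y`) and `R` (from `Y` to `Z`) put one on top of the other: the
equivalence relation on `X ⊕ Y ⊕ Z` generated by both. -/
def stack (P : Setoid (X ⊕ Y)) (R : Setoid (Y ⊕ Z)) : Setoid (X ⊕ (Y ⊕ Z)) :=
  P.map (Sum.map id Sum.inl) ⊔ R.map Sum.inr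

/-- Vertical composition of diagrams: stack them and forget the middle. -/
def vcomp (P : Setoid (X ⊕ Y)) (R : Setoid (Y ⊕ Z)) : Setoid (X ⊕ Z) :=
  (stack P R).comap (Sum.map id Sum.inr)

theorem IsBrauer.eq_of_le {A : Type*} {r s : Setoid A} (hr : IsBrauer r) (hs : IsBrauer s)
    (h : r ≤ s) : r = s := by
  refine le_antisymm h fun {a b} hab => ?_
  by_cases hba : b = a
  · rw [hba]
  · obtain ⟨c, ⟨hc, hac⟩, -⟩ := hr a
    have := (hs a).unique ⟨hba, hab⟩ ⟨hc, h hac⟩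
    rw [this]; exact hac

theorem map_le_iff' {A B : Type*} {r : Setoid A} {f : A → B} {s : Setoid B} :
    r.map f ≤ s ↔ ∀ a b, r a b → s (f a) (f b) := by
  constructor
  · intro h a b hab
    exact h (Setoid.le_comap_map hab)
  · intro h
    apply Setoid.eqvGen_le
    rintro _ _ ⟨a, b, hab, rfl, rfl⟩
    exact h a b hab

theorem stack_le_iff {P : Setoid (X ⊕ Y)} {R : Setoid (Y ⊕ Z)} {T : Setoid (X ⊕ (Y ⊕ Z))} :
    stack P R ≤ T ↔
      (∀ a b, P a b → T (Sum.map id Sum.inl a) (Sum.map id Sum.inl b)) ∧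
      (∀ a b, R a b → T (Sum.inr a) (Sum.inr b)) := by
  rw [stack, sup_le_iff, map_le_iff', map_le_iff']

theorem stack_left (P : Setoid (X ⊕ Y)) (R : Setoid (Y ⊕ Z)) {a b : X ⊕ Y} (h : P a b) :
    stack P R (Sum.map id Sum.inl a) (Sum.map id Sum.inl b) :=
  (stack_le_iff.1 le_rfl).1 a b h

theorem stack_right (P : Setoid (X ⊕ Y)) (R : Setoid (Y ⊕ Z)) {a b : Y ⊕ Z} (h : R a b) :
    stack P R (Sum.inr a) (Sum.inr b) :=
  (stack_le_iff.1 le_rfl).2 a b h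

/-- In a finite set with two involutions `σ`, `τ` without common fixed points, the orbit of a
fixed point of `τ` contains exactly one other point fixed by one of them. -/
theorem two_involutions {B : Type*} [Finite B] (σ τ : Equiv.Perm B)
    (hσ : ∀ b, σ (σ b) = b) (hτ : ∀ b, τ (τ b) = b) (hst : ∀ b, ¬ (σ b = b ∧ τ b = b))
    (J : Setoid B) (hJ : ∀ b, J b (σ b) ∧ J b (τ b))
    (hJ' : ∀ T : Setoid B, (∀ b, T b (σ b) ∧ T b (τ b)) → J ≤ T)
    (x : B) (hx : τ x = x) : ∃! b, b ≠ x ∧ J x b ∧ (σ b = b ∨ τ b = b) := by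
  set c : Equiv.Perm B := σ * τ with hc
  have hσi : σ⁻¹ = σ := by
    ext b; rw [Equiv.Perm.inv_eq_iff_eq]; exact (hσ b).symm
  have hτi : τ⁻¹ = τ := by
    ext b; rw [Equiv.Perm.inv_eq_iff_eq]; exact (hτ b).symm
  have hττ : τ * τ = 1 := by ext b; simp [hτ]
  have hci : c⁻¹ = τ * σ := by rw [hc, mul_inv_rev, hσi, hτi]
  have hconj : τ * c * τ⁻¹ = c⁻¹ := by
    rw [hci, hc, hτi, mul_assoc, mul_assoc, hττ, mul_one]
  have hτk : ∀ k : ℤ, τ ((c ^ k) x) = (c ^ (-k)) x := by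
    intro k
    have h1 : τ * c ^ k * τ⁻¹ = c ^ (-k) := by
      rw [← conj_zpow, hconj, inv_zpow, zpow_neg]
    calc τ ((c ^ k) x) = (τ * c ^ k * τ⁻¹) x := by
          rw [hτi]; simp [hx]
      _ = _ := by rw [h1]
  have hσk : ∀ k : ℤ, σ ((c ^ k) x) = (c ^ (1 - k)) x := by
    intro k
    have h1 : σ = c * τ := by rw [hc, mul_assoc, hττ, mul_one]
    calc σ ((c ^ k) x) = c (τ ((c ^ k) x)) := by conv_lhs => { rw [h1, Equiv.Perm.mul_apply] }
      _ = _ := by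
        rw [hτk, sub_eq_add_neg, zpow_add, zpow_one]; rfl
  have horb : ∀ b, J x b → ∃ k : ℤ, b = (c ^ k) x := by
    let T : Setoid B := Setoid.ker fun b => ∃ k : ℤ, b = (c ^ k) x
    have hTτ : ∀ b, (∃ k : ℤ, b = (c ^ k) x) → ∃ k : ℤ, τ b = (c ^ k) x := by
      rintro _ ⟨k, rfl⟩; exact ⟨_, hτk k⟩
    have hTσ : ∀ b, (∃ k : ℤ, b = (c ^ k) x) → ∃ k : ℤ, σ b = (c ^ k) x := by
      rintro _ ⟨k, rfl⟩; exact ⟨_, hσk k⟩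
    have hle : J ≤ T := by
      refine hJ' T fun b => ⟨?_, ?_⟩
      · exact propext ⟨hTσ b, fun h => by simpa [hσ] using hTσ _ h⟩
      · exact propext ⟨hTτ b, fun h => by simpa [hτ] using hTτ _ h⟩
    intro b hb
    have : (∃ k : ℤ, x = (c ^ k) x) = (∃ k : ℤ, b = (c ^ k) x) := hle hb
    exact this.mp ⟨0, by simp⟩
  have hcJ : ∀ b, J b (c b) := fun b => J.trans (hJ b).2 (hJ (τ b)).1
  have hcJk : ∀ k : ℤ, J x ((c ^ k) x) := by
    have hn : ∀ n : ℕ, J x ((c ^ n) x) := by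
      intro n
      induction n with
      | zero => exact J.refl _
      | succ n ih => rw [pow_succ']; exact J.trans ih (hcJ _)
    intro k
    obtain ⟨n, rfl | rfl⟩ := k.eq_nat_or_neg
    · simpa using hn n
    · rw [← hτk]; exact J.trans (by simpa using hn n) (hJ _).2
  set n : ℕ := Function.minimalPeriod c x with hn
  have hper : ∀ k l : ℤ, (c ^ k) x = (c ^ l) x ↔ (n : ℤ) ∣ k - l := by
    intro k l
    have := MulAction.zpow_smul_eq_iff_minimalPeriod_dvd (a := c) (b := x) (n := k - l)
    rw [Equiv.Perm.smul_def] at this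
    have h2 : Function.minimalPeriod (c • · : B → B) x = n := rfl
    rw [h2] at this
    rw [← this, sub_eq_neg_add, zpow_add, zpow_neg, Equiv.Perm.mul_apply,
      Equiv.Perm.inv_eq_iff_eq]
  have hnpos : 0 < n := by
    apply Function.minimalPeriod_pos_of_mem_periodicPts
    exact Function.Injective.mem_periodicPts c.injective x
  have hσx : σ x ≠ x := fun h => hst x ⟨h, hx⟩
  have hx0 : (c ^ (0 : ℤ)) x = x := by simp
  have hfixτ : ∀ k : ℤ, τ ((c ^ k) x) = (c ^ k) x ↔ (n : ℤ) ∣ 2 * k := by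
    intro k; rw [hτk, hper, ← dvd_neg]; ring_nf
  have hfixσ : ∀ k : ℤ, σ ((c ^ k) x) = (c ^ k) x ↔ (n : ℤ) ∣ 2 * k - 1 := by
    intro k; rw [hσk, hper, ← dvd_neg]; ring_nf
  have hne : ∀ k : ℤ, (c ^ k) x = x ↔ (n : ℤ) ∣ k := by
    intro k
    conv_lhs => rhs; rw [← hx0]
    rw [hper, sub_zero]
  have hn1 : n ≠ 1 := by
    intro h
    apply hσx
    have := (hfixσ 0).2 (by rw [h]; simp)
    simpa using this
  rcases Nat.even_or_odd' n with ⟨m, hm | hm⟩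
  · have hnm : (n : ℤ) = 2 * m := by exact_mod_cast hm
    refine ⟨(c ^ (m : ℤ)) x, ⟨?_, hcJk _, Or.inr ((hfixτ _).2 (by rw [hnm]))⟩, ?_⟩
    · rw [Ne, hne, hnm]
      rintro ⟨q, hq⟩
      have hm0 : (m : ℤ) ≠ 0 := by omega
      have : (m : ℤ) * (1 - 2 * q) = 0 := by linarith
      rcases mul_eq_zero.1 this with h | h <;> omega
    · rintro b ⟨hbx, hb, hfix⟩
      obtain ⟨k, rfl⟩ := horb b hb
      rw [hfixσ, hfixτ] at hfix
      rw [Ne, hne] at hbx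
      rw [hper]
      rw [hnm] at *
      rcases hfix with h | h
      · obtain ⟨q, hq⟩ := h
        exfalso
        have : (2 : ℤ) ∣ 2 * k - 1 := ⟨m * q, by rw [hq]; ring⟩
        omega
      · obtain ⟨q, hq⟩ := h
        have hk : k = m * q := by linarith
        rcases Int.even_or_odd' q with ⟨w, hw | hw⟩
        · exact absurd ⟨w, by rw [hk, hw]; ring⟩ hbx
        · exact ⟨w, by rw [hk, hw]; ring⟩
  · have hnm : (n : ℤ) = 2 * m + 1 := by exact_mod_cast hm
    refine ⟨(c ^ (m + 1 : ℤ)) x, ⟨?_, hcJk _, Or.inl ((hfixσ _).2 ⟨1, by rw [hnm]; ring⟩)⟩, ?_⟩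
    · rw [Ne, hne]
      intro h
      have := Int.le_of_dvd (by positivity) h
      omega
    · rintro b ⟨hbx, hb, hfix⟩
      obtain ⟨k, rfl⟩ := horb b hb
      rw [hfixσ, hfixτ] at hfix
      rw [Ne, hne] at hbx
      rw [hper]
      have hcop : IsCoprime (n : ℤ) 2 := ⟨1, -m, by rw [hnm]; ring⟩
      rcases hfix with h | h
      · apply hcop.dvd_of_dvd_mul_left
        have h3 : (n : ℤ) ∣ (2 * k - 1) - n := dvd_sub h dvd_rfl
        have : 2 * (k - (m + 1)) = (2 * k - 1) - (n : ℤ) := by rw [hnm]; ring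
        rw [this]; exact h3
      · exact absurd (hcop.dvd_of_dvd_mul_left h) hbx

/-- The involution exchanging the two members of every class. -/
theorem IsBrauer.exists_partner {A : Type*} {r : Setoid A} (hr : IsBrauer r) :
    ∃ p : A → A, (∀ a, p (p a) = a) ∧ (∀ a, p a ≠ a) ∧ (∀ a, r a (p a)) ∧
      ∀ a b, r a b → b = a ∨ b = p a := by
  choose p hp hu using hr
  refine ⟨p, fun a => ?_, fun a => (hp a).1, fun a => (hp a).2, fun a b hab => ?_⟩
  · exact (hu (p a) a ⟨(hp a).1.symm, r.symm (hp a).2⟩).symm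
  · by_cases h : b = a
    · exact Or.inl h
    · exact Or.inr (hu a b ⟨h, hab⟩)

theorem IsBrauer.vcomp [Finite X] [Finite Y] [Finite Z] {P : Setoid (X ⊕ Y)} {R : Setoid (Y ⊕ Z)}
    (hP : IsBrauer P) (hR : IsBrauer R) : IsBrauer (vcomp P R) := by
  obtain ⟨p, hpp, hpn, hpr, hpe⟩ := hP.exists_partner
  obtain ⟨q, hqq, hqn, hqr, hqe⟩ := hR.exists_partner
  let i : X ⊕ Y → X ⊕ (Y ⊕ Z) := Sum.map id Sum.inl
  have hi : Function.Injective i := Function.Injective.sumMap Function.injective_id Sum.inl_injective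
  let σ' : X ⊕ (Y ⊕ Z) → X ⊕ (Y ⊕ Z) := fun b => match b with
    | Sum.inl x => i (p (Sum.inl x))
    | Sum.inr (Sum.inl y) => i (p (Sum.inr y))
    | Sum.inr (Sum.inr z) => Sum.inr (Sum.inr z)
  let τ' : X ⊕ (Y ⊕ Z) → X ⊕ (Y ⊕ Z) := fun b => match b with
    | Sum.inl x => Sum.inl x
    | Sum.inr w => Sum.inr (q w)
  have hσi : ∀ a, σ' (i a) = i (p a) := by rintro (x | y) <;> rfl
  have hσ : ∀ b, σ' (σ' b) = b := by
    rintro (x | y | z)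
    · change σ' (i _) = _
      rw [hσi, hpp]; rfl
    · change σ' (i _) = _
      rw [hσi, hpp]; rfl
    · rfl
  have hτ : ∀ b, τ' (τ' b) = b := by
    rintro (x | w)
    · rfl
    · change Sum.inr (q (q w)) = _
      rw [hqq]
  let σ : Equiv.Perm (X ⊕ (Y ⊕ Z)) := ⟨σ', σ', hσ, hσ⟩
  let τ : Equiv.Perm (X ⊕ (Y ⊕ Z)) := ⟨τ', τ', hτ, hτ⟩
  have fσ : ∀ b, σ b = b ↔ ∃ z, b = Sum.inr (Sum.inr z) := by
    intro b
    constructor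
    · rintro h
      rcases b with x | y | z
      · exact absurd (hi (a₁ := p (Sum.inl x)) (a₂ := Sum.inl x) h) (hpn _)
      · exact absurd (hi (a₁ := p (Sum.inr y)) (a₂ := Sum.inr y) h) (hpn _)
      · exact ⟨z, rfl⟩
    · rintro ⟨z, rfl⟩; rfl
  have fτ : ∀ b, τ b = b ↔ ∃ x, b = Sum.inl x := by
    intro b
    constructor
    · rintro h
      rcases b with x | w
      · exact ⟨x, rfl⟩
      · exact absurd (Sum.inr_injective h) (hqn _)
    · rintro ⟨z, rfl⟩; rfl
  have hst : ∀ b, ¬ (σ b = b ∧ τ b = b) := by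
    rintro b ⟨h1, h2⟩
    rw [fσ] at h1
    rw [fτ] at h2
    obtain ⟨z, rfl⟩ := h1
    obtain ⟨x, hx⟩ := h2
    cases hx
  have hJ : ∀ b, stack P R b (σ b) ∧ stack P R b (τ b) := by
    rintro (x | y | z)
    · exact ⟨stack_left P R (hpr (Sum.inl x)), (stack P R).refl _⟩
    · exact ⟨stack_left P R (hpr (Sum.inr y)), stack_right P R (hqr _)⟩
    · exact ⟨(stack P R).refl _, stack_right P R (hqr _)⟩
  have hJ' : ∀ T : Setoid (X ⊕ (Y ⊕ Z)), (∀ b, T b (σ b) ∧ T b (τ b)) → stack P R ≤ T := by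
    intro T hT
    rw [stack_le_iff]
    constructor
    · intro a b hab
      rcases hpe a b hab with rfl | rfl
      · exact T.refl _
      · have := (hT (i a)).1
        rwa [show σ (i a) = i (p a) from hσi a] at this
    · intro a b hab
      rcases hqe a b hab with rfl | rfl
      · exact T.refl _
      · exact (hT (Sum.inr a)).2
  let k : X ⊕ Z → X ⊕ (Y ⊕ Z) := Sum.map id Sum.inr
  have hk : Function.Injective k := Function.Injective.sumMap Function.injective_id Sum.inr_injective
  have hbd : ∀ b, (σ b = b ∨ τ b = b) ↔ ∃ a, k a = b := by
    intro b
    rw [fσ, fτ]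
    constructor
    · rintro (⟨z, rfl⟩ | ⟨x, rfl⟩)
      · exact ⟨Sum.inr z, rfl⟩
      · exact ⟨Sum.inl x, rfl⟩
    · rintro ⟨x | z, rfl⟩
      · exact Or.inr ⟨x, rfl⟩
      · exact Or.inl ⟨z, rfl⟩
  have key : ∀ a : X ⊕ Z, ∃! b, b ≠ k a ∧ stack P R (k a) b ∧ (σ b = b ∨ τ b = b) := by
    intro a
    rcases a with x | z
    · exact two_involutions σ τ hσ hτ hst _ hJ hJ' _ rfl
    · have := two_involutions τ σ hτ hσ (fun b h => hst b h.symm) (stack P R)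
        (fun b => (hJ b).symm) (fun T hT => hJ' T fun b => (hT b).symm)
        (Sum.inr (Sum.inr z)) rfl
      simp only [or_comm (a := τ _ = _)] at this
      exact this
  intro a
  obtain ⟨b, ⟨h1, h2, h3⟩, hu⟩ := key a
  obtain ⟨b', rfl⟩ := (hbd b).1 h3
  refine ⟨b', ⟨fun h => h1 (by rw [h]), h2⟩, ?_⟩
  rintro b'' ⟨h4, h5⟩
  exact hk (hu (k b'') ⟨fun h => h4 (hk h), h5, (hbd _).2 ⟨_, rfl⟩⟩)

theorem comap_sup_map_le {A B : Type*} (i : A → B) (P : Setoid B) (Q : Setoid A) :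
    (P ⊔ Q.map i).comap i ≤ P.comap i ⊔ Q := by
  set K₀ : Setoid A := P.comap i ⊔ Q with hK₀
  have hPK : ∀ a b, P (i a) (i b) → K₀ a b := fun a b h => (le_sup_left : P.comap i ≤ K₀) h
  let K : Setoid B :=
    { r := fun b b' => P b b' ∨ ∃ a a', P b (i a) ∧ K₀ a a' ∧ P (i a') b'
      iseqv :=
        { refl := fun b => Or.inl (P.refl b)
          symm := by
            rintro b b' (h | ⟨a, a', h1, h2, h3⟩)
            · exact Or.inl (P.symm h)
            · exact Or.inr ⟨a', a, P.symm h3, K₀.symm h2, P.symm h1⟩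
          trans := by
            rintro b b' b'' (h | ⟨a, a', h1, h2, h3⟩) (h' | ⟨c, c', h4, h5, h6⟩)
            · exact Or.inl (P.trans h h')
            · exact Or.inr ⟨c, c', P.trans h h4, h5, h6⟩
            · exact Or.inr ⟨a, a', h1, h2, P.trans h3 h'⟩
            · exact Or.inr ⟨a, c', h1,
                K₀.trans h2 (K₀.trans (hPK _ _ (P.trans h3 h4)) h5), h6⟩ } }
  have hle : P ⊔ Q.map i ≤ K := by
    refine sup_le (fun {b b'} h => Or.inl h) (map_le_iff'.2 fun a b h => ?_)
    exact Or.inr ⟨a, b, P.refl _, (le_sup_right : Q ≤ K₀) h, P.refl _⟩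
  intro a b h
  rcases hle h with h | ⟨c, c', h1, h2, h3⟩
  · exact hPK _ _ h
  · exact K₀.trans (hPK _ _ h1) (K₀.trans h2 (hPK _ _ h3))

end Composition

theorem vcomp_assoc_le {X Y Z W : Type} (P : Setoid (X ⊕ Y)) (R : Setoid (Y ⊕ Z))
    (S : Setoid (Z ⊕ W)) : vcomp P (vcomp R S) ≤ vcomp (vcomp P R) S := by
  -- everything takes place in `X ⊕ Y ⊕ Z ⊕ W`; the points of `Y` are eliminated first
  let lP : X ⊕ Y → X ⊕ (Y ⊕ (Z ⊕ W)) := Sum.map id Sum.inl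
  let lPR : X ⊕ (Y ⊕ Z) → X ⊕ (Y ⊕ (Z ⊕ W)) := Sum.map id (Sum.map id Sum.inl)
  let i : X ⊕ (Z ⊕ W) → X ⊕ (Y ⊕ (Z ⊕ W)) := Sum.map id Sum.inr
  have hlPR : Function.Injective lPR :=
    Function.Injective.sumMap Function.injective_id
      (Function.Injective.sumMap Function.injective_id Sum.inl_injective)
  set J₀ := (stack P R).map lPR with hJ₀
  set S' : Setoid (X ⊕ (Z ⊕ W)) := S.map Sum.inr with hS'
  set J := J₀ ⊔ S'.map i with hJ
  have h1 : J.comap i ≤ stack (vcomp P R) S := by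
    refine (comap_sup_map_le i J₀ S').trans (sup_le ?_ ?_)
    · intro a b hab
      have hab' : J₀ (i a) (i b) := hab
      rw [hJ₀, Setoid.coe_map_of_ker_le _ _ (by rw [Setoid.ker_eq_bot_iff.2 hlPR]; exact bot_le)]
        at hab'
      rcases hab' with ⟨c, d, hcd, hc, hd⟩ | h
      · have hlift : ∀ (c : X ⊕ (Y ⊕ Z)) (a : X ⊕ (Z ⊕ W)), lPR c = i a →
            ∃ e : X ⊕ Z, c = Sum.map id Sum.inr e ∧ a = Sum.map id Sum.inl e := by
          rintro (x | y | z) (x' | z' | w') h <;> simp [lPR, i] at h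
          · subst h; exact ⟨Sum.inl x, rfl, rfl⟩
          · subst h; exact ⟨Sum.inr z, rfl, rfl⟩
        obtain ⟨e, rfl, rfl⟩ := hlift c a hc
        obtain ⟨e', rfl, rfl⟩ := hlift d b hd
        exact stack_left (vcomp P R) S hcd
      · have : a = b :=
          Function.Injective.sumMap Function.injective_id Sum.inr_injective h
        rw [this]
    · exact le_sup_right
  have h2 : stack P (vcomp R S) ≤ J.comap (Sum.map id (Sum.map id Sum.inr)) := by
    rw [stack_le_iff]
    constructor
    · intro a b hab
      have h3 : J₀ (lPR (Sum.map id Sum.inl a)) (lPR (Sum.map id Sum.inl b)) :=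
        Setoid.le_comap_map (stack_left P R hab)
      have h4 : J (lPR (Sum.map id Sum.inl a)) (lPR (Sum.map id Sum.inl b)) :=
        (le_sup_left : J₀ ≤ J) h3
      rcases a with a | a <;> rcases b with b | b <;> exact h4
    · have h5 : stack R S ≤ J.comap Sum.inr := by
        rw [stack_le_iff]
        constructor
        · intro a b hab
          have h3 : J (lPR (Sum.inr a)) (lPR (Sum.inr b)) :=
            (le_sup_left : J₀ ≤ J) (Setoid.le_comap_map (stack_right P R hab))
          rcases a with a | a <;> rcases b with b | b <;> exact h3
        · intro a b hab
          have h3 : S' (Sum.inr a) (Sum.inr b) := Setoid.le_comap_map hab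
          exact (le_sup_right : S'.map i ≤ J) (Setoid.le_comap_map h3)
      intro a b hab
      have h6 := h5 hab
      rcases a with a | a <;> rcases b with b | b <;> exact h6
  intro a b hab
  have h7 := h2 hab
  have h8 : J.comap i (Sum.map id Sum.inr a) (Sum.map id Sum.inr b) := by
    rcases a with a | a <;> rcases b with b | b <;> exact h7
  exact h1 h8

/-- Objects of `Br`: the finite ordinals. -/
structure Br : Type where
  ord : ℕ

namespace Br

/-- Arrows of `Br` from `n` to `m`: equivalence relations on the disjoint union of `n` and `m` all
of whose classes have exactly two elements. -/
def Diagram (n m : ℕ) : Type := { r : Setoid (Fin n ⊕ Fin m) // IsBrauer r }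

theorem Diagram.ext_of_le {n m : ℕ} {f g : Diagram n m} (h : f.1 ≤ g.1) : f = g :=
  Subtype.ext (f.2.eq_of_le g.2 h)

/-- The points `inl (h i)` and `inr i` are joined by parallel lines. -/
theorem isBrauer_lines {n m : ℕ} (h : n = m) :
    IsBrauer (Setoid.ker (Sum.elim (Fin.cast h) id : Fin n ⊕ Fin m → Fin m)) := by
  subst h
  rintro (i | i)
  · refine ⟨Sum.inr i, ⟨by simp, rfl⟩, ?_⟩
    rintro (j | j) ⟨h1, h2⟩
    · have h2' : i = j := h2
      exact absurd (by rw [h2']) h1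
    · have h2' : i = j := h2
      rw [h2']
  · refine ⟨Sum.inl i, ⟨by simp, rfl⟩, ?_⟩
    rintro (j | j) ⟨h1, h2⟩
    · have h2' : i = j := h2
      rw [h2']
    · have h2' : i = j := h2
      exact absurd (by rw [h2']) h1

/-- The diagram of parallel lines, joining the `i`-th point of the source with the `i`-th point of
the target. -/
def lines {n m : ℕ} (h : n = m) : Diagram n m :=
  ⟨Setoid.ker (Sum.elim (Fin.cast h) id), isBrauer_lines h⟩

/-- Vertical composition. -/
def Diagram.comp {n m k : ℕ} (f : Diagram n m) (g : Diagram m k) : Diagram n k :=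
  ⟨vcomp f.1 g.1, f.2.vcomp g.2⟩

theorem lines_rel_left {n m : ℕ} (h : n = m) (i : Fin n) :
    (lines h).1 (Sum.inl i) (Sum.inr (Fin.cast h i)) := rfl

theorem lines_le_iff {n m : ℕ} (h : n = m) {T : Setoid (Fin n ⊕ Fin m)} :
    (lines h).1 ≤ T ↔ ∀ i, T (Sum.inl i) (Sum.inr (Fin.cast h i)) := by
  constructor
  · intro hT i
    exact hT (lines_rel_left h i)
  · intro hT
    subst h
    rintro (i | i) (j | j) hij
    · have hij' : i = j := hij
      subst hij'; exact T.refl _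
    · have hij' : i = j := hij
      subst hij'; exact hT i
    · have hij' : i = j := hij
      subst hij'; exact T.symm (hT i)
    · have hij' : i = j := hij
      subst hij'; exact T.refl _

theorem comp_rel_left {n m k : ℕ} (f : Diagram n m) (g : Diagram m k) (i : Fin n) (w : Fin m)
    (j : Fin k) (h1 : f.1 (Sum.inl i) (Sum.inr w)) (h2 : g.1 (Sum.inl w) (Sum.inr j)) :
    (f.comp g).1 (Sum.inl i) (Sum.inr j) :=
  (stack f.1 g.1).trans (stack_left f.1 g.1 h1) (stack_right f.1 g.1 h2)

/-- Composing with parallel lines on the source side relabels the source. -/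
theorem lines_comp {n m k : ℕ} (h : n = m) (f : Diagram m k) :
    ((lines h).comp f).1 = f.1.comap (Sum.map (Fin.cast h) id) := by
  symm
  subst h
  refine IsBrauer.eq_of_le (by simpa using f.2) ((lines rfl).comp f).2 ?_
  have key : ∀ a : Fin n ⊕ Fin k, stack (lines (rfl : n = n)).1 f.1
      (Sum.map id Sum.inr a) (Sum.inr a) := by
    rintro (i | j)
    · exact stack_left (lines rfl).1 f.1 (lines_rel_left rfl i)
    · exact (stack _ f.1).refl _
  intro a b hab
  have hab' : f.1 a b := by simpa [Setoid.comap_rel] using hab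
  exact (stack (lines rfl).1 f.1).trans (key a) ((stack (lines rfl).1 f.1).trans (stack_right (lines rfl).1 f.1 hab')
    ((stack (lines rfl).1 f.1).symm (key b)))

/-- Composing with parallel lines on the target side relabels the target. -/
theorem comp_lines {n m k : ℕ} (h : m = k) (f : Diagram n m) :
    (f.comp (lines h)).1 = f.1.comap (Sum.map id (Fin.cast h.symm)) := by
  symm
  subst h
  refine IsBrauer.eq_of_le (by simpa using f.2) (f.comp (lines rfl)).2 ?_
  have key : ∀ a : Fin n ⊕ Fin m, stack f.1 (lines (rfl : m = m)).1
      (Sum.map id Sum.inr a) (Sum.map id Sum.inl a) := by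
    rintro (i | j)
    · exact (stack f.1 _).refl _
    · exact (stack f.1 (lines rfl).1).symm (stack_right f.1 (lines rfl).1 (lines_rel_left rfl j))
  intro a b hab
  have hab' : f.1 a b := by simpa [Setoid.comap_rel] using hab
  exact (stack f.1 (lines rfl).1).trans (key a) ((stack f.1 (lines rfl).1).trans
    (stack_left f.1 (lines rfl).1 hab') ((stack f.1 (lines rfl).1).symm (key b)))

theorem lines_comp_lines {n m k : ℕ} (h : n = m) (h' : m = k) :
    (lines h).comp (lines h') = lines (h.trans h') := by
  subst h h'
  apply Subtype.ext
  rw [lines_comp]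
  ext a b
  simp [Setoid.comap_rel]

instance : Category Br where
  Hom a b := Diagram a.ord b.ord
  id a := lines (rfl : a.ord = a.ord)
  comp f g := f.comp g
  id_comp f := Subtype.ext (by rw [lines_comp]; ext a b; simp [Setoid.comap_rel])
  comp_id f := Subtype.ext (by rw [comp_lines]; ext a b; simp [Setoid.comap_rel])
  assoc f g h := (Diagram.ext_of_le (vcomp_assoc_le f.1 g.1 h.1)).symm

/-! Horizontal composition -/

section Horizontal

variable {n m n' m' : ℕ}

/-- The embedding of the points of the left-hand diagram. -/
def leftPt (n m n' m' : ℕ) : Fin n ⊕ Fin m → Fin (n + n') ⊕ Fin (m + m') :=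
  Sum.map (Fin.castAdd n') (Fin.castAdd m')

/-- The embedding of the points of the right-hand diagram. -/
def rightPt (n m n' m' : ℕ) : Fin n' ⊕ Fin m' → Fin (n + n') ⊕ Fin (m + m') :=
  Sum.map (Fin.natAdd n) (Fin.natAdd m)

theorem leftPt_injective : Function.Injective (leftPt n m n' m') :=
  Function.Injective.sumMap (Fin.castAdd_injective _ _) (Fin.castAdd_injective _ _)

theorem rightPt_injective : Function.Injective (rightPt n m n' m') :=
  Function.Injective.sumMap (Fin.natAdd_injective _ _) (Fin.natAdd_injective _ _)

theorem leftPt_ne_rightPt (a : Fin n ⊕ Fin m) (b : Fin n' ⊕ Fin m') :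
    leftPt n m n' m' a ≠ rightPt n m n' m' b := by
  rcases a with a | a <;> rcases b with b | b <;> simp [leftPt, rightPt, Fin.ext_iff] <;> omega

theorem pt_cases (a : Fin (n + n') ⊕ Fin (m + m')) :
    (∃ u, a = leftPt n m n' m' u) ∨ ∃ v, a = rightPt n m n' m' v := by
  rcases a with a | a
  · induction a using Fin.addCases with
    | left i => exact Or.inl ⟨Sum.inl i, rfl⟩
    | right i => exact Or.inr ⟨Sum.inl i, rfl⟩
  · induction a using Fin.addCases with
    | left i => exact Or.inl ⟨Sum.inr i, rfl⟩
    | right i => exact Or.inr ⟨Sum.inr i, rfl⟩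

/-- Two diagrams side by side. -/
def beside (f : Setoid (Fin n ⊕ Fin m)) (g : Setoid (Fin n' ⊕ Fin m')) :
    Setoid (Fin (n + n') ⊕ Fin (m + m')) where
  r a b := (∃ u v, f u v ∧ a = leftPt n m n' m' u ∧ b = leftPt n m n' m' v) ∨
    (∃ u v, g u v ∧ a = rightPt n m n' m' u ∧ b = rightPt n m n' m' v)
  iseqv :=
    { refl := fun a => by
        rcases pt_cases a with ⟨u, rfl⟩ | ⟨u, rfl⟩
        · exact Or.inl ⟨u, u, f.refl u, rfl, rfl⟩
        · exact Or.inr ⟨u, u, g.refl u, rfl, rfl⟩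
      symm := by
        rintro a b (⟨u, v, h, rfl, rfl⟩ | ⟨u, v, h, rfl, rfl⟩)
        · exact Or.inl ⟨v, u, f.symm h, rfl, rfl⟩
        · exact Or.inr ⟨v, u, g.symm h, rfl, rfl⟩
      trans := by
        rintro a b c (⟨u, v, h, rfl, rfl⟩ | ⟨u, v, h, rfl, rfl⟩)
          (⟨u', v', h', h1, rfl⟩ | ⟨u', v', h', h1, rfl⟩)
        · obtain rfl := leftPt_injective h1
          exact Or.inl ⟨u, v', f.trans h h', rfl, rfl⟩
        · exact absurd h1 (leftPt_ne_rightPt _ _)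
        · exact absurd h1.symm (leftPt_ne_rightPt _ _)
        · obtain rfl := rightPt_injective h1
          exact Or.inr ⟨u, v', g.trans h h', rfl, rfl⟩ }

theorem isBrauer_beside {f : Setoid (Fin n ⊕ Fin m)} {g : Setoid (Fin n' ⊕ Fin m')}
    (hf : IsBrauer f) (hg : IsBrauer g) : IsBrauer (beside f g) := by
  intro a
  rcases pt_cases a with ⟨u, rfl⟩ | ⟨u, rfl⟩
  · obtain ⟨v, ⟨h1, h2⟩, h3⟩ := hf u
    refine ⟨leftPt n m n' m' v, ⟨fun h => h1 (leftPt_injective h), Or.inl ⟨_, _, h2, rfl, rfl⟩⟩, ?_⟩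
    rintro b ⟨hb, ⟨u', v', h', h4, rfl⟩ | ⟨u', v', h', h4, rfl⟩⟩
    · obtain rfl := leftPt_injective h4
      rw [h3 v' ⟨fun h => hb (by rw [h]), h'⟩]
    · exact absurd h4 (leftPt_ne_rightPt _ _)
  · obtain ⟨v, ⟨h1, h2⟩, h3⟩ := hg u
    refine ⟨rightPt n m n' m' v,
      ⟨fun h => h1 (rightPt_injective h), Or.inr ⟨_, _, h2, rfl, rfl⟩⟩, ?_⟩
    rintro b ⟨hb, ⟨u', v', h', h4, rfl⟩ | ⟨u', v', h', h4, rfl⟩⟩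
    · exact absurd h4.symm (leftPt_ne_rightPt _ _)
    · obtain rfl := rightPt_injective h4
      rw [h3 v' ⟨fun h => hb (by rw [h]), h'⟩]

/-- Horizontal composition. -/
def Diagram.tensor (f : Diagram n m) (g : Diagram n' m') : Diagram (n + n') (m + m') :=
  ⟨beside f.1 g.1, isBrauer_beside f.2 g.2⟩

theorem tensor_left (f : Diagram n m) (g : Diagram n' m') {u v : Fin n ⊕ Fin m} (h : f.1 u v) :
    (f.tensor g).1 (leftPt n m n' m' u) (leftPt n m n' m' v) :=
  Or.inl ⟨u, v, h, rfl, rfl⟩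

theorem tensor_right (f : Diagram n m) (g : Diagram n' m') {u v : Fin n' ⊕ Fin m'}
    (h : g.1 u v) : (f.tensor g).1 (rightPt n m n' m' u) (rightPt n m n' m' v) :=
  Or.inr ⟨u, v, h, rfl, rfl⟩

theorem tensor_le {f : Diagram n m} {g : Diagram n' m'} {T : Setoid (Fin (n + n') ⊕ Fin (m + m'))}
    (h1 : ∀ u v, f.1 u v → T (leftPt n m n' m' u) (leftPt n m n' m' v))
    (h2 : ∀ u v, g.1 u v → T (rightPt n m n' m' u) (rightPt n m n' m' v)) :
    (f.tensor g).1 ≤ T := by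
  rintro a b (⟨u, v, h, rfl, rfl⟩ | ⟨u, v, h, rfl, rfl⟩)
  · exact h1 u v h
  · exact h2 u v h

end Horizontal

theorem lines_tensor_lines {n m n' m' : ℕ} (h : n = m) (h' : n' = m') :
    (lines h).tensor (lines h') = lines (by rw [h, h']) := by
  symm
  apply Diagram.ext_of_le
  subst h h'
  rw [lines_le_iff]
  intro i
  induction i using Fin.addCases with
  | left i => exact tensor_left (lines rfl) (lines rfl) (lines_rel_left rfl i)
  | right i => exact tensor_right (lines rfl) (lines rfl) (lines_rel_left rfl i)

theorem comp_tensor_comp {n m k n' m' k' : ℕ} (f : Diagram n m) (g : Diagram m k)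
    (f' : Diagram n' m') (g' : Diagram m' k') :
    (f.comp g).tensor (f'.comp g') = (f.tensor f').comp (g.tensor g') := by
  apply Diagram.ext_of_le
  apply tensor_le
  · have : stack f.1 g.1 ≤ (stack (f.tensor f').1 (g.tensor g').1).comap
        (Sum.map (Fin.castAdd n') (leftPt m k m' k')) := by
      rw [stack_le_iff]
      constructor
      · intro a b hab
        have := stack_left (f.tensor f').1 (g.tensor g').1 (tensor_left f f' hab)
        rcases a with a | a <;> rcases b with b | b <;> exact this
      · intro a b hab
        exact stack_right (f.tensor f').1 (g.tensor g').1 (tensor_left g g' hab)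
    intro u v huv
    have := this huv
    rcases u with a | a <;> rcases v with b | b <;> exact this
  · have : stack f'.1 g'.1 ≤ (stack (f.tensor f').1 (g.tensor g').1).comap
        (Sum.map (Fin.natAdd n) (rightPt m k m' k')) := by
      rw [stack_le_iff]
      constructor
      · intro a b hab
        have := stack_left (f.tensor f').1 (g.tensor g').1 (tensor_right f f' hab)
        rcases a with a | a <;> rcases b with b | b <;> exact this
      · intro a b hab
        exact stack_right (f.tensor f').1 (g.tensor g').1 (tensor_right g g' hab)
    intro u v huv
    have := this huv
    rcases u with a | a <;> rcases v with b | b <;> exact this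

/-- The diagram of `r_x`: a single cap, joining the two points of the target. -/
def cap : Diagram 0 2 :=
  ⟨⊤, by
    rintro (i | i)
    · exact i.elim0
    · fin_cases i
      · refine ⟨Sum.inr 1, ⟨by simp, trivial⟩, ?_⟩
        rintro (j | j) ⟨h, -⟩
        · exact j.elim0
        · fin_cases j
          · exact absurd rfl h
          · rfl
      · refine ⟨Sum.inr 0, ⟨by simp, trivial⟩, ?_⟩
        rintro (j | j) ⟨h, -⟩
        · exact j.elim0
        · fin_cases j
          · rfl
          · exact absurd rfl h⟩

/-- The diagram of `t_{x,y,z}`: the second and the third of the four points of the source are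
joined by a cup, the first (fourth) point of the source is joined with the first (second) point of
the target. Points are joined when they receive the same label. -/
def cup : Diagram (2 + 2) 2 :=
  ⟨Setoid.ker (Sum.elim ![0, 1, 1, 2] ![0, 2] : Fin (2 + 2) ⊕ Fin 2 → Fin 3), by
    unfold IsBrauer
    simp only [Setoid.ker_def]
    unfold ExistsUnique
    decide⟩

/-! The equations of `M_≤` hold in `Br` -/

theorem tensor_assoc {n m n' m' n'' m'' : ℕ} (f : Diagram n m) (g : Diagram n' m')
    (h : Diagram n'' m'') (e₁ : n + (n' + n'') = n + n' + n'') (e₂ : m + (m' + m'') = m + m' + m'') :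
    (lines e₁).comp ((f.tensor g).tensor h) = (f.tensor (g.tensor h)).comp (lines e₂) := by
  apply Diagram.ext_of_le
  rw [lines_comp, comp_lines]
  have hT : ((f.tensor g).tensor h).1 ≤
      (f.tensor (g.tensor h)).1.comap (Sum.map (Fin.cast e₁.symm) (Fin.cast e₂.symm)) := by
    apply tensor_le
    · have : (f.tensor g).1 ≤ ((f.tensor (g.tensor h)).1.comap
          (Sum.map (Fin.cast e₁.symm) (Fin.cast e₂.symm))).comap
          (leftPt (n + n') (m + m') n'' m'') := by
        apply tensor_le
        · intro u v huv
          have := tensor_left f (g.tensor h) huv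
          rcases u with a | a <;> rcases v with b | b <;> exact this
        · intro u v huv
          have := tensor_right f (g.tensor h) (tensor_left g h huv)
          rcases u with a | a <;> rcases v with b | b <;> exact this
      intro u v huv
      exact this huv
    · intro u v huv
      have := tensor_right f (g.tensor h) (tensor_right g h huv)
      have e : ∀ w, Sum.map (Fin.cast e₁.symm) (Fin.cast e₂.symm)
          (rightPt (n + n') (m + m') n'' m'' w) =
          rightPt n m (n' + n'') (m' + m'') (rightPt n' m' n'' m'' w) := by
        rintro (a | a) <;> simp [rightPt, Fin.ext_iff, Nat.add_assoc]
      rw [Setoid.comap_rel, e, e]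
      exact this
  intro a b hab
  have := hT hab
  rcases a with a | a <;> rcases b with b | b <;> exact this

theorem tensor_unit_right {n m : ℕ} (f : Diagram n m) :
    (lines (Nat.add_zero n)).comp f =
      (f.tensor (lines (rfl : 0 = 0))).comp (lines (Nat.add_zero m)) := by
  symm
  apply Diagram.ext_of_le
  rw [lines_comp, comp_lines]
  have hT : (f.tensor (lines (rfl : 0 = 0))).1 ≤ f.1.comap
      (Sum.map (Fin.cast (Nat.add_zero n)) (Fin.cast (Nat.add_zero m))) := by
    apply tensor_le
    · intro u v huv
      rcases u with a | a <;> rcases v with b | b <;> exact huv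
    · rintro (u | u) <;> exact u.elim0
  intro a b hab
  have := hT hab
  rcases a with a | a <;> rcases b with b | b <;> exact this

theorem tensor_unit_left {n m : ℕ} (f : Diagram n m) :
    (lines (Nat.zero_add n)).comp f =
      ((lines (rfl : 0 = 0)).tensor f).comp (lines (Nat.zero_add m)) := by
  symm
  apply Diagram.ext_of_le
  rw [lines_comp, comp_lines]
  have hT : ((lines (rfl : 0 = 0)).tensor f).1 ≤ f.1.comap
      (Sum.map (Fin.cast (Nat.zero_add n)) (Fin.cast (Nat.zero_add m))) := by
    apply tensor_le
    · rintro (u | u) <;> exact u.elim0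
    · intro u v huv
      have e : ∀ w, Sum.map (Fin.cast (Nat.zero_add n)) (Fin.cast (Nat.zero_add m))
          (rightPt 0 0 n m w) = w := by
        rintro (a | a) <;> simp [rightPt]
      rw [Setoid.comap_rel, e, e]
      exact huv
  intro a b hab
  have := hT hab
  rcases a with a | a <;> rcases b with b | b <;> exact this

theorem cap_right : ((lines (rfl : 2 = 2)).tensor cap).comp cup = lines (Nat.add_zero 2) := by
  symm
  apply Diagram.ext_of_le
  rw [lines_le_iff]
  have hl := fun i => stack_left ((lines (rfl : 2 = 2)).tensor cap).1 cup.1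
    (tensor_left (lines rfl) cap (lines_rel_left rfl i))
  have hc := stack_left ((lines (rfl : 2 = 2)).tensor cap).1 cup.1
    (tensor_right (lines rfl) cap (u := Sum.inr 0) (v := Sum.inr 1) trivial)
  have hr := fun a b (h : cup.1 a b) => stack_right ((lines (rfl : 2 = 2)).tensor cap).1 cup.1 h
  set J := stack ((lines (rfl : 2 = 2)).tensor cap).1 cup.1 with hJ
  intro i
  fin_cases i
  · exact J.trans (hl 0) (hr (Sum.inl 0) (Sum.inr 0) rfl)
  · exact J.trans (hl 1) (J.trans (hr (Sum.inl 1) (Sum.inl 2) rfl)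
      (J.trans hc (hr (Sum.inl 3) (Sum.inr 1) rfl)))

theorem cap_left : (cap.tensor (lines (rfl : 2 = 2))).comp cup = lines (Nat.zero_add 2) := by
  symm
  apply Diagram.ext_of_le
  rw [lines_le_iff]
  have hl := fun i => stack_left (cap.tensor (lines (rfl : 2 = 2))).1 cup.1
    (tensor_right cap (lines rfl) (lines_rel_left rfl i))
  have hc := stack_left (cap.tensor (lines (rfl : 2 = 2))).1 cup.1
    (tensor_left cap (lines rfl) (u := Sum.inr 0) (v := Sum.inr 1) trivial)
  have hr := fun a b (h : cup.1 a b) => stack_right (cap.tensor (lines (rfl : 2 = 2))).1 cup.1 h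
  set J := stack (cap.tensor (lines (rfl : 2 = 2))).1 cup.1 with hJ
  intro i
  fin_cases i
  · exact J.trans (hl 0) (J.trans (hr (Sum.inl 2) (Sum.inl 1) rfl)
      (J.trans (J.symm hc) (hr (Sum.inl 0) (Sum.inr 0) rfl)))
  · exact J.trans (hl 1) (hr (Sum.inl 3) (Sum.inr 1) rfl)

theorem cup_assoc (e : 2 + (2 + 2) = 2 + 2 + 2) :
    ((lines (rfl : 2 = 2)).tensor cup).comp cup =
      ((lines e).comp (cup.tensor (lines (rfl : 2 = 2)))).comp cup := by
  -- both sides are given by the same labelling of the points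
  let lab : Fin (2 + (2 + 2)) ⊕ Fin 2 → Fin 4 := Sum.elim ![0, 1, 1, 2, 2, 3] ![0, 3]
  have hlab : IsBrauer (Setoid.ker lab) := by
    unfold IsBrauer
    simp only [Setoid.ker_def]
    unfold ExistsUnique
    decide
  let D : Diagram (2 + (2 + 2)) 2 := ⟨Setoid.ker lab, hlab⟩
  have hD : ∀ T : Setoid (Fin (2 + (2 + 2)) ⊕ Fin 2),
      T (Sum.inl 0) (Sum.inr 0) → T (Sum.inl 1) (Sum.inl 2) → T (Sum.inl 3) (Sum.inl 4) →
      T (Sum.inl 5) (Sum.inr 1) → D.1 ≤ T := by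
    intro T h0 h1 h2 h3
    have key : ∀ a, T a (![Sum.inl 0, Sum.inl 1, Sum.inl 3, Sum.inl 5] (lab a)) := by
      rintro (i | i)
      · fin_cases i
        · exact T.refl _
        · exact T.refl _
        · exact T.symm h1
        · exact T.refl _
        · exact T.symm h2
        · exact T.refl _
      · fin_cases i
        · exact T.symm h0
        · exact T.symm h3
    intro a b hab
    have hab' : lab a = lab b := hab
    have hb := key b
    rw [← hab'] at hb
    exact T.trans (key a) (T.symm hb)
  have e1 : D = ((lines (rfl : 2 = 2)).tensor cup).comp cup := by
    apply Diagram.ext_of_le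
    have hl := fun i => stack_left ((lines (rfl : 2 = 2)).tensor cup).1 cup.1
      (tensor_left (lines rfl) cup (lines_rel_left rfl i))
    have hc := fun a b (h : cup.1 a b) =>
      stack_left ((lines (rfl : 2 = 2)).tensor cup).1 cup.1 (tensor_right (lines rfl) cup h)
    have hr := fun a b (h : cup.1 a b) =>
      stack_right ((lines (rfl : 2 = 2)).tensor cup).1 cup.1 h
    set J := stack ((lines (rfl : 2 = 2)).tensor cup).1 cup.1 with hJ
    apply hD
    · exact J.trans (hl 0) (hr (Sum.inl 0) (Sum.inr 0) rfl)
    · exact J.trans (hl 1) (J.trans (hr (Sum.inl 1) (Sum.inl 2) rfl)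
        (J.symm (hc (Sum.inl 0) (Sum.inr 0) rfl)))
    · exact hc (Sum.inl 1) (Sum.inl 2) rfl
    · exact J.trans (hc (Sum.inl 3) (Sum.inr 1) rfl) (hr (Sum.inl 3) (Sum.inr 1) rfl)
  have e2 : D = ((lines e).comp (cup.tensor (lines (rfl : 2 = 2)))).comp cup := by
    apply Diagram.ext_of_le
    have hx : ∀ a b, (cup.tensor (lines (rfl : 2 = 2))).1
        (Sum.map (Fin.cast e) id a) (Sum.map (Fin.cast e) id b) →
        ((lines e).comp (cup.tensor (lines (rfl : 2 = 2)))).1 a b := by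
      intro a b h
      rw [lines_comp]
      exact h
    have hl' := fun a b (h : (cup.tensor (lines (rfl : 2 = 2))).1
        (Sum.map (Fin.cast e) id a) (Sum.map (Fin.cast e) id b)) =>
      stack_left ((lines e).comp (cup.tensor (lines (rfl : 2 = 2)))).1 cup.1 (hx a b h)
    have hr := fun a b (h : cup.1 a b) =>
      stack_right ((lines e).comp (cup.tensor (lines (rfl : 2 = 2)))).1 cup.1 h
    have tl := fun a b (h : cup.1 a b) => tensor_left cup (lines (rfl : 2 = 2)) h
    have tr := fun i => tensor_right cup (lines (rfl : 2 = 2)) (lines_rel_left rfl i)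
    set J := stack ((lines e).comp (cup.tensor (lines (rfl : 2 = 2)))).1 cup.1 with hJ
    apply hD
    · exact J.trans (hl' (Sum.inl 0) (Sum.inr 0) (tl (Sum.inl 0) (Sum.inr 0) rfl))
        (hr (Sum.inl 0) (Sum.inr 0) rfl)
    · exact hl' (Sum.inl 1) (Sum.inl 2) (tl (Sum.inl 1) (Sum.inl 2) rfl)
    · exact J.trans (hl' (Sum.inl 3) (Sum.inr 1) (tl (Sum.inl 3) (Sum.inr 1) rfl))
        (J.trans (hr (Sum.inl 1) (Sum.inl 2) rfl)
          (J.symm (hl' (Sum.inl 4) (Sum.inr 2) (tr 0))))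
    · exact J.trans (hl' (Sum.inl 5) (Sum.inr 3) (tr 1)) (hr (Sum.inl 3) (Sum.inr 1) rfl)
  exact e1.symm.trans e2

end Br

/-! ### The functor `G` -/

/-- The number of occurrences of variables in a formula. -/
def Formula.occ {𝒱 : Type u} : Formula 𝒱 → ℕ
  | .leq _ _ => 2
  | .top => 0
  | .and A B => A.occ + B.occ

/-- The diagram of an arrow term. -/
def ArrowTerm.diagram {𝒱 : Type u} {s : Variant} :
    {A B : Formula 𝒱} → ArrowTerm 𝒱 s A B → Br.Diagram A.occ B.occ
  | _, _, .one _ => Br.lines rfl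
  | _, _, .bTo A B C => Br.lines (Nat.add_assoc A.occ B.occ C.occ).symm
  | _, _, .bFrom A B C => Br.lines (Nat.add_assoc A.occ B.occ C.occ)
  | _, _, .dTo A => Br.lines (Nat.add_zero A.occ)
  | _, _, .dFrom A => Br.lines (Nat.add_zero A.occ).symm
  | _, _, .sTo A => Br.lines (Nat.zero_add A.occ)
  | _, _, .sFrom A => Br.lines (Nat.zero_add A.occ).symm
  | _, _, .r _ _ => Br.cap
  | _, _, .t _ _ _ _ => Br.cup
  | _, _, .wedge f g => f.diagram.tensor g.diagram
  | _, _, .comp g f => f.diagram.comp g.diagram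

theorem TermEq.diagram_eq {𝒱 : Type u} {s : Variant} {A B : Formula 𝒱}
    {f g : ArrowTerm 𝒱 s A B} (h : TermEq f g) : f.diagram = g.diagram := by
  induction h with
  | refl f => rfl
  | symm _ ih => exact ih.symm
  | trans _ _ ih₁ ih₂ => exact ih₁.trans ih₂
  | congr_wedge _ _ ih₁ ih₂ => exact congrArg₂ Br.Diagram.tensor ih₁ ih₂
  | congr_comp _ _ ih₁ ih₂ => exact congrArg₂ Br.Diagram.comp ih₁ ih₂
  | @cat1_left A B f =>
    exact Category.comp_id (X := (⟨A.occ⟩ : Br)) (Y := ⟨B.occ⟩) f.diagram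
  | @cat1_right A B f =>
    exact Category.id_comp (X := (⟨A.occ⟩ : Br)) (Y := ⟨B.occ⟩) f.diagram
  | @cat2 A B C D h g f =>
    exact (Category.assoc (W := (⟨A.occ⟩ : Br)) (X := ⟨B.occ⟩) (Y := ⟨C.occ⟩) (Z := ⟨D.occ⟩)
      f.diagram g.diagram h.diagram).symm
  | wedge1 A B => exact Br.lines_tensor_lines rfl rfl
  | wedge2 g₁ f₁ g₂ f₂ => exact Br.comp_tensor_comp _ _ _ _
  | b_nat f g h => exact Br.tensor_assoc _ _ _ _ _
  | d_nat f => exact Br.tensor_unit_right _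
  | s_nat f => exact Br.tensor_unit_left _
  | bb_left A B C => exact Br.lines_comp_lines _ _
  | bb_right A B C => exact Br.lines_comp_lines _ _
  | b5 A B C D =>
    simp only [ArrowTerm.diagram]
    erw [Br.lines_tensor_lines, Br.lines_tensor_lines, Br.lines_comp_lines, Br.lines_comp_lines,
      Br.lines_comp_lines]
  | dd_left A => exact Br.lines_comp_lines _ _
  | dd_right A => exact Br.lines_comp_lines _ _
  | ss_left A => exact Br.lines_comp_lines _ _
  | ss_right A => exact Br.lines_comp_lines _ _
  | bds A C =>
    simp only [ArrowTerm.diagram]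
    erw [Br.lines_tensor_lines, Br.lines_tensor_lines, Br.lines_comp_lines]
  | rtd hr ht x y => exact Br.cap_right
  | rts hr ht x y => exact Br.cap_left
  | tb ht x y z u => exact Br.cup_assoc _

/-- The functor `G` from `M_≤` (or one of its variants) to `Br`: it sends a formula to the number
of occurrences of variables in it, and the arrow named by an arrow term to the diagram of this
arrow term. -/
def G (𝒱 : Type u) (s : Variant) : M 𝒱 s ⥤ Br where
  obj A := ⟨A.formula.occ⟩
  map {A B} := Quotient.lift (s := termSetoid 𝒱 s A.formula B.formula)
    (fun f => (f.diagram : Br.Diagram A.formula.occ B.formula.occ)) fun _ _ h => TermEq.diagram_eq h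
  map_id _ := rfl
  map_comp := by
    rintro A B C ⟨f⟩ ⟨g⟩
    rfl

end LinearEquality

namespace LinearEquality

universe u

open MonoidalCategory

variable {𝒱 : Type u} {s : Variant}

/-! ### The monoidal structure of `M_≤` -/

/-! Every arrow has a normal form, and a normal form can be recovered from its source, its target
and its diagram. Mac Lane coherence disposes of the structural arrows: parallel arrows of the free
monoidal category over the atoms are equal, so a shape matters only through its list of atoms.

An arrow into an atom is normal (`IsBlock`) if, up to a structural arrow, it is `r_x`, an identity,
or a right-nested composite of arrows `t` in which no `r` occurs. An arrow into a compound target is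
normal (`IsNormal`) if it is a structural arrow followed by a tensor product of normal arrows into
the parts. Normal arrows are closed under composition (`IsNormal.comp`). The crucial case,
`IsBlock.ten_trans`, is a cut elimination: `(rtσ)` and `(rtδ)` remove an `r` met by a `t`, and
`(tb)` renests to the right. Since generators are normal, so is every arrow (`isNormal_onShapes`).

A block is already determined by its source and target (`IsBlock.eq`). For compound targets the only
freedom left is where the source list is cut between the factors, and this the diagram shows: in a
normal arrow the first source point is always joined with a target point (`IsNormal.firstThrough`),
so two different cuts would give different diagrams (`Br.source_le_of_tensor_eq`). Then
`IsNormal.eq_of_diagram_eq` follows by induction on the target.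

Each equation for `r` and `t` is used only where the arrows in it are present, so the three systems
are treated at once, with `s` as a parameter. -/

instance : MonoidalCategoryStruct (M 𝒱 s) where
  tensorObj A B := ⟨.and A.formula B.formula⟩
  tensorHom := Quotient.map₂ (fun f g => f.wedge g) fun _ _ hf _ _ hg => TermEq.congr_wedge hf hg
  whiskerLeft X _ _ := Quotient.map (fun f => (ArrowTerm.one X.formula).wedge f)
    fun _ _ hf => TermEq.congr_wedge (TermEq.refl _) hf
  whiskerRight f X := Quotient.map (fun f => f.wedge (ArrowTerm.one X.formula))
    (fun _ _ hf => TermEq.congr_wedge hf (TermEq.refl _)) f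
  tensorUnit := ⟨.top⟩
  -- The associator goes from left to right nesting, so `bFrom` is its forward direction and `bTo`
  -- its inverse.
  associator A B C :=
    ⟨(ArrowTerm.bFrom A.formula B.formula C.formula).toHom,
      (ArrowTerm.bTo A.formula B.formula C.formula).toHom,
      Quotient.sound (TermEq.bb_right _ _ _), Quotient.sound (TermEq.bb_left _ _ _)⟩
  leftUnitor A := ⟨(ArrowTerm.sTo A.formula).toHom, (ArrowTerm.sFrom A.formula).toHom,
    Quotient.sound (TermEq.ss_left _), Quotient.sound (TermEq.ss_right _)⟩
  rightUnitor A := ⟨(ArrowTerm.dTo A.formula).toHom, (ArrowTerm.dFrom A.formula).toHom,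
    Quotient.sound (TermEq.dd_left _), Quotient.sound (TermEq.dd_right _)⟩

theorem id_tensorHom_id' (A B : M 𝒱 s) : (𝟙 A ⊗ₘ 𝟙 B) = 𝟙 (A ⊗ B) :=
  Quotient.sound (TermEq.wedge1 _ _)

theorem tensorHom_comp_tensorHom' {A₁ B₁ C₁ A₂ B₂ C₂ : M 𝒱 s} (f₁ : A₁ ⟶ B₁) (f₂ : A₂ ⟶ B₂)
    (g₁ : B₁ ⟶ C₁) (g₂ : B₂ ⟶ C₂) : (f₁ ⊗ₘ f₂) ≫ (g₁ ⊗ₘ g₂) = (f₁ ≫ g₁) ⊗ₘ (f₂ ≫ g₂) := by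
  induction f₁ using Quotient.inductionOn
  induction f₂ using Quotient.inductionOn
  induction g₁ using Quotient.inductionOn
  induction g₂ using Quotient.inductionOn
  exact Quotient.sound (TermEq.symm (TermEq.wedge2 _ _ _ _))

/-- The given equations concern `bTo`, the inverse of the associator. This fact and the next two
record them in that form, to be inverted afterwards. -/
theorem associator_inv_naturality' {A B C D E F : M 𝒱 s} (f : A ⟶ D) (g : B ⟶ E) (h : C ⟶ F) :
    (α_ A B C).inv ≫ ((f ⊗ₘ g) ⊗ₘ h) = (f ⊗ₘ (g ⊗ₘ h)) ≫ (α_ D E F).inv := by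
  induction f using Quotient.inductionOn
  induction g using Quotient.inductionOn
  induction h using Quotient.inductionOn
  exact Quotient.sound (TermEq.b_nat _ _ _)

theorem pentagon_inv' (A B C D : M 𝒱 s) :
    (α_ A B (C ⊗ D)).inv ≫ (α_ (A ⊗ B) C D).inv =
      ((𝟙 A ⊗ₘ (α_ B C D).inv) ≫ (α_ A (B ⊗ C) D).inv) ≫ ((α_ A B C).inv ⊗ₘ 𝟙 D) :=
  Quotient.sound (TermEq.b5 _ _ _ _)

theorem triangle_inv' (A C : M 𝒱 s) :
    (α_ A (𝟙_ _) C).inv = (𝟙 A ⊗ₘ (λ_ C).hom) ≫ ((ρ_ A).inv ⊗ₘ 𝟙 C) :=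
  Quotient.sound (TermEq.bds _ _)

instance : MonoidalCategory (M 𝒱 s) :=
  MonoidalCategory.ofTensorHom
    (id_tensorHom_id := id_tensorHom_id')
    (id_tensorHom := fun X _ _ f => by
      induction f using Quotient.inductionOn; rfl)
    (tensorHom_id := fun f X => by
      induction f using Quotient.inductionOn; rfl)
    (tensorHom_comp_tensorHom := tensorHom_comp_tensorHom')
    (associator_naturality := fun f g h => by
      rw [← Iso.inv_comp_eq, ← Category.assoc, associator_inv_naturality', Category.assoc,
        Iso.inv_hom_id, Category.comp_id])
    (leftUnitor_naturality := fun f => by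
      induction f using Quotient.inductionOn
      exact Quotient.sound (TermEq.symm (TermEq.s_nat _)))
    (rightUnitor_naturality := fun f => by
      induction f using Quotient.inductionOn
      exact Quotient.sound (TermEq.symm (TermEq.d_nat _)))
    (pentagon := fun A B C D => by
      have key := pentagon_inv' A B C D
      -- The three-arrow side of the pentagon followed by its inverse, which `key` identifies with
      -- the inverse of the two-arrow side; cancelling that inverse leaves the pentagon.
      have h : (((α_ A B C).hom ⊗ₘ 𝟙 D) ≫ (α_ A (B ⊗ C) D).hom ≫ (𝟙 A ⊗ₘ (α_ B C D).hom)) ≫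
          (((𝟙 A ⊗ₘ (α_ B C D).inv) ≫ (α_ A (B ⊗ C) D).inv) ≫ ((α_ A B C).inv ⊗ₘ 𝟙 D)) = 𝟙 _ := by
        have h₁ : (𝟙 A ⊗ₘ (α_ B C D).hom) ≫ (𝟙 A ⊗ₘ (α_ B C D).inv) = 𝟙 _ := by
          rw [tensorHom_comp_tensorHom', Iso.hom_inv_id, Category.comp_id, id_tensorHom_id']
        have h₂ : ((α_ A B C).hom ⊗ₘ 𝟙 D) ≫ ((α_ A B C).inv ⊗ₘ 𝟙 D) = 𝟙 _ := by
          rw [tensorHom_comp_tensorHom', Iso.hom_inv_id, Category.comp_id, id_tensorHom_id']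
        slice_lhs 3 4 => rw [h₁]
        simp only [Category.id_comp, Iso.hom_inv_id_assoc]
        exact h₂
      rw [← key, ← Category.assoc, Iso.comp_inv_eq, Iso.comp_inv_eq, Category.id_comp] at h
      exact h)
    (triangle := fun A C => by
      rw [← Iso.eq_inv_comp, triangle_inv', Category.assoc, tensorHom_comp_tensorHom',
        Iso.inv_hom_id, Category.comp_id, id_tensorHom_id', Category.comp_id])

/-! ### Structural arrows -/

/-- Formulae, seen as objects of the free monoidal category over the set of atoms. -/
abbrev Shape (𝒱 : Type u) := FreeMonoidalCategory (𝒱 × 𝒱)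

namespace Shape

/-- The shape of the atom `x ≤ y`. -/
abbrev atom (x y : 𝒱) : Shape 𝒱 := FreeMonoidalCategory.of (x, y)

/-- The sequence of atoms of a shape. -/
def atoms : Shape 𝒱 → List (𝒱 × 𝒱)
  | .of a => [a]
  | .unit => []
  | .tensor X Y => atoms X ++ atoms Y

@[simp] theorem atoms_of (a : 𝒱 × 𝒱) : atoms (.of a) = [a] := rfl

@[simp] theorem atoms_unit : atoms (𝟙_ (Shape 𝒱)) = [] := rfl

@[simp] theorem atoms_tensor (X Y : Shape 𝒱) : atoms (X ⊗ Y) = atoms X ++ atoms Y := rfl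

/-- The list of atoms is the invariant by which impossible combinations of normal forms are excluded
later on. -/
theorem atoms_eq {X Y : Shape 𝒱} (u : X ⟶ Y) : atoms X = atoms Y := by
  induction u using FreeMonoidalCategory.Hom.inductionOn <;> simp_all

/-- The right-nested shape with a given sequence of atoms. -/
def ofList : List (𝒱 × 𝒱) → Shape 𝒱
  | [] => 𝟙_ _
  | a :: l => FreeMonoidalCategory.of a ⊗ ofList l

theorem nonempty_ofList_append (l l' : List (𝒱 × 𝒱)) :
    Nonempty (ofList l ⊗ ofList l' ⟶ ofList (l ++ l')) := by
  induction l with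
  | nil => exact ⟨(λ_ _).hom⟩
  | cons a l ih => exact ih.elim fun v => ⟨(α_ _ _ _).hom ≫ (_ ◁ v)⟩

theorem nonempty_hom_ofList (X : Shape 𝒱) : Nonempty (X ⟶ ofList X.atoms) := by
  induction X with
  | of a => exact ⟨(ρ_ _).inv⟩
  | unit => exact ⟨𝟙 _⟩
  | tensor X Y ihX ihY =>
    exact ihX.elim fun u => ihY.elim fun v => (nonempty_ofList_append _ _).elim fun w =>
      ⟨(u ⊗ₘ v) ≫ w⟩

/-- Both shapes map to the right-nested shape of their common list, and arrows of the free monoidal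
category are invertible. With `can_eq`, shapes with the same atoms are thus interchangeable along a
unique structural arrow. -/
theorem nonempty_hom {X Y : Shape 𝒱} (h : X.atoms = Y.atoms) : Nonempty (X ⟶ Y) :=
  (nonempty_hom_ofList X).elim fun u => (nonempty_hom_ofList Y).elim fun v =>
    ⟨u ≫ eqToHom (by rw [h]) ≫ Groupoid.inv v⟩

/-- The formula of a shape, as an object of `M_≤` or of one of its variants. -/
def formula (s : Variant) (X : Shape 𝒱) : M 𝒱 s :=
  FreeMonoidalCategory.projectObj (fun a => ⟨.leq a.1 a.2⟩) X

/-- The number of occurrences of variables in a shape. -/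
abbrev occ (s : Variant) (X : Shape 𝒱) : ℕ := (formula s X).formula.occ

/-- Translates between positions in diagrams and positions in lists of atoms. -/
theorem occ_eq (s : Variant) (X : Shape 𝒱) : X.occ s = 2 * X.atoms.length := by
  induction X with
  | of a => rfl
  | unit => rfl
  | tensor X Y ihX ihY =>
    change occ s X + occ s Y = 2 * (atoms X ++ atoms Y).length
    rw [ihX, ihY, List.length_append, mul_add]

end Shape

/-! ### Arrows of `M_≤` between shapes. -/

open Shape

/-- Arrows of `M_≤` between the formulae of two shapes. -/
abbrev Arr (s : Variant) (X Y : Shape 𝒱) := X.formula s ⟶ Y.formula s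

/-- The tensor product of arrows between shapes. -/
def ten {X Y X' Y' : Shape 𝒱} (f : Arr s X Y) (g : Arr s X' Y') : Arr s (X ⊗ X') (Y ⊗ Y') :=
  f ⊗ₘ g

/-- The structural arrow of `M_≤` that comes from an arrow of the free monoidal category. -/
def can {X Y : Shape 𝒱} (u : X ⟶ Y) : Arr s X Y :=
  (FreeMonoidalCategory.project _).map u

/-- The arrow `r_x`, between shapes. -/
def reflArr (hr : s.HasR) (x : 𝒱) : Arr s (𝟙_ _) (atom x x) := (ArrowTerm.r hr x).toHom

/-- The arrow `t_{x,y,z}`, between shapes. -/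
def transArr (ht : s.HasT) (x y z : 𝒱) : Arr s (atom x y ⊗ atom y z) (atom x z) :=
  (ArrowTerm.t ht x y z).toHom

@[simp] theorem can_id (X : Shape 𝒱) : (can (𝟙 X) : Arr s X X) = 𝟙 _ := rfl

theorem can_comp {X Y Z : Shape 𝒱} (u : X ⟶ Y) (v : Y ⟶ Z) :
    (can (u ≫ v) : Arr s X Z) = can u ≫ can v :=
  (FreeMonoidalCategory.project _).map_comp u v

theorem can_tensor {X Y X' Y' : Shape 𝒱} (u : X ⟶ Y) (v : X' ⟶ Y') :
    (can (u ⊗ₘ v) : Arr s _ _) = ten (can u) (can v) := by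
  induction u using Quotient.inductionOn
  induction v using Quotient.inductionOn
  rfl

theorem ten_comp {X Y Z X' Y' Z' : Shape 𝒱} (f : Arr s X Y) (g : Arr s Y Z)
    (f' : Arr s X' Y') (g' : Arr s Y' Z') :
    ten (f ≫ g) (f' ≫ g') = ten f f' ≫ ten g g' :=
  (tensorHom_comp_tensorHom' _ _ _ _).symm

/-- Mac Lane coherence: the hom-sets of the free monoidal category have at most one element. -/
theorem can_eq {X Y : Shape 𝒱} (u v : X ⟶ Y) : (can u : Arr s X Y) = can v := by
  rw [Subsingleton.elim u v]

theorem can_inv_comp {X Y : Shape 𝒱} (u : X ⟶ Y) :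
    (can (Groupoid.inv u) ≫ can u : Arr s Y Y) = 𝟙 _ := by
  rw [← can_comp, Groupoid.inv_comp, can_id]

theorem ten_ten_can_assoc {X Y Z X' Y' Z' : Shape 𝒱} (f : Arr s X X') (g : Arr s Y Y')
    (h : Arr s Z Z') :
    ten (ten f g) h ≫ can (α_ _ _ _).hom = can (α_ _ _ _).hom ≫ ten f (ten g h) :=
  associator_naturality f g h

theorem ten_ten_can_assoc_inv {X Y Z X' Y' Z' : Shape 𝒱} (f : Arr s X X') (g : Arr s Y Y')
    (h : Arr s Z Z') :
    ten f (ten g h) ≫ can (α_ _ _ _).inv = can (α_ _ _ _).inv ≫ ten (ten f g) h :=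
  associator_inv_naturality f g h

theorem ten_id_can_left {X Y : Shape 𝒱} (f : Arr s X Y) :
    ten (𝟙 (Shape.formula s (𝟙_ _))) f ≫ can (λ_ _).hom = can (λ_ _).hom ≫ f :=
  Eq.trans (congrArg (· ≫ _) (id_tensorHom _ f)) (leftUnitor_naturality f)

theorem ten_id_can_right {X Y : Shape 𝒱} (f : Arr s X Y) :
    ten f (𝟙 (Shape.formula s (𝟙_ _))) ≫ can (ρ_ _).hom = can (ρ_ _).hom ≫ f :=
  Eq.trans (congrArg (· ≫ _) (tensorHom_id f _)) (rightUnitor_naturality f)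

theorem comp_can_left_inv {X Y : Shape 𝒱} (f : Arr s X Y) :
    f ≫ can (λ_ _).inv = can (λ_ _).inv ≫ ten (𝟙 (Shape.formula s (𝟙_ _))) f :=
  Eq.trans (leftUnitor_inv_naturality f) (congrArg (_ ≫ ·) (id_tensorHom _ f).symm)

theorem comp_can_right_inv {X Y : Shape 𝒱} (f : Arr s X Y) :
    f ≫ can (ρ_ _).inv = can (ρ_ _).inv ≫ ten f (𝟙 (Shape.formula s (𝟙_ _))) :=
  Eq.trans (rightUnitor_inv_naturality f) (congrArg (_ ≫ ·) (tensorHom_id f _).symm)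

theorem ten_refl_trans (hr : s.HasR) (ht : s.HasT) (x y : 𝒱) :
    ten (𝟙 ((atom x y).formula s)) (reflArr hr y) ≫ transArr ht x y y = can (ρ_ _).hom :=
  Quotient.sound (TermEq.rtd hr ht x y)

theorem refl_ten_trans (hr : s.HasR) (ht : s.HasT) (x y : 𝒱) :
    ten (reflArr hr y) (𝟙 ((atom y x).formula s)) ≫ transArr ht y y x = can (λ_ _).hom :=
  Quotient.sound (TermEq.rts hr ht x y)

/-- Equation `(tb)` in the direction of normalisation: a `t` nested on the left is moved to the
right. -/
theorem trans_assoc (ht : s.HasT) (x y z w : 𝒱) :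
    ten (transArr ht x y z) (𝟙 ((atom z w).formula s)) ≫ transArr ht x z w =
      can (α_ _ _ _).hom ≫ ten (𝟙 ((atom x y).formula s)) (transArr ht y z w) ≫
        transArr ht x y w := by
  have h : ten (𝟙 ((atom x y).formula s)) (transArr ht y z w) ≫ transArr ht x y w =
      (can (α_ _ _ _).inv ≫ ten (transArr ht x y z) (𝟙 ((atom z w).formula s))) ≫
        transArr ht x z w :=
    Quotient.sound (TermEq.tb ht x y z w)
  rw [h, ← Category.assoc, ← Category.assoc, ← can_comp, Iso.hom_inv_id, can_id, Category.id_comp]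

/-! ### Arrows in normal form -/

/-- Arrows into an atom in normal form: `r_x`, an identity, or a composite of arrows `t` nested to
the right, preceded by a structural arrow. -/
inductive IsBlock : ∀ {X : Shape 𝒱} {a : 𝒱 × 𝒱}, Arr s X (.of a) → Prop
  | refl {X : Shape 𝒱} (u : X ⟶ 𝟙_ _) (hr : s.HasR) (x : 𝒱) :
      IsBlock (X := X) (a := (x, x)) (can u ≫ reflArr hr x)
  | can {X : Shape 𝒱} {a : 𝒱 × 𝒱} (u : X ⟶ .of a) : IsBlock (can u)
  -- The condition `hX'` keeps `r` from being the inner block. It makes the source of this case have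
  -- at least two atoms, so that the three cases exclude one another.
  | trans {X X' : Shape 𝒱} (x y z : 𝒱) (u : X ⟶ atom x y ⊗ X') (hX' : X'.atoms ≠ [])
      (ht : s.HasT) (f : Arr s X' (atom y z)) :
      IsBlock f → IsBlock (X := X) (a := (x, z)) (can u ≫ ten (𝟙 _) f ≫ transArr ht x y z)

/-- Arrows in normal form: tensor products of arrows into the atoms of the target, preceded by
structural arrows. -/
def IsNormal : ∀ {X : Shape 𝒱} (Y : Shape 𝒱), Arr s X Y → Prop
  | _, .of _, f => IsBlock f
  | X, .unit, f => ∃ u : X ⟶ 𝟙_ _, f = can u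
  | X, .tensor Y₁ Y₂, f => ∃ (X₁ X₂ : Shape 𝒱) (u : X ⟶ X₁ ⊗ X₂) (f₁ : Arr s X₁ Y₁)
      (f₂ : Arr s X₂ Y₂), IsNormal Y₁ f₁ ∧ IsNormal Y₂ f₂ ∧ f = can u ≫ ten f₁ f₂

/-! ### Closure properties of normal forms. -/

theorem IsBlock.can_comp {W X : Shape 𝒱} {a : 𝒱 × 𝒱} (v : W ⟶ X) {f : Arr s X (.of a)}
    (hf : IsBlock f) : IsBlock (LinearEquality.can v ≫ f) := by
  cases hf with
  | refl u hr x =>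
    rw [← Category.assoc, ← LinearEquality.can_comp]
    exact .refl _ hr x
  | can u =>
    rw [← LinearEquality.can_comp]
    exact .can _
  | trans x y z u hX' ht f hf =>
    rw [← Category.assoc, ← LinearEquality.can_comp]
    exact .trans x y z _ hX' ht f hf

theorem IsNormal.can_comp {W X Y : Shape 𝒱} (v : W ⟶ X) {f : Arr s X Y}
    (hf : IsNormal Y f) : IsNormal Y (can v ≫ f) := by
  cases Y with
  | of a => exact IsBlock.can_comp v hf
  | unit =>
    obtain ⟨u, rfl⟩ := hf
    exact ⟨v ≫ u, (LinearEquality.can_comp _ _).symm⟩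
  | tensor Y₁ Y₂ =>
    obtain ⟨X₁, X₂, u, f₁, f₂, h₁, h₂, rfl⟩ := hf
    exact ⟨X₁, X₂, v ≫ u, f₁, f₂, h₁, h₂, by
      rw [LinearEquality.can_comp, Category.assoc]⟩

theorem IsNormal.ten {X₁ X₂ Y₁ Y₂ : Shape 𝒱} {f₁ : Arr s X₁ Y₁} {f₂ : Arr s X₂ Y₂}
    (h₁ : IsNormal Y₁ f₁) (h₂ : IsNormal Y₂ f₂) : IsNormal (Y₁ ⊗ Y₂) (ten f₁ f₂) :=
  ⟨X₁, X₂, 𝟙 _, f₁, f₂, h₁, h₂, by rw [can_id, Category.id_comp]⟩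

theorem isNormal_id_unit : IsNormal (𝟙_ (Shape 𝒱)) (𝟙 (Shape.formula s (𝟙_ _))) :=
  ⟨𝟙 _, rfl⟩

/-- By naturality, a structural arrow after a tensor product of normal arrows can be moved before
it, where the normal form absorbs it. -/
theorem IsNormal.comp_can {X Y Z : Shape 𝒱} {f : Arr s X Y} (hf : IsNormal Y f) (v : Y ⟶ Z) :
    IsNormal Z (f ≫ can v) := by
  induction v using FreeMonoidalCategory.Hom.inductionOn generalizing X with
  | id Y => rwa [can_id, Category.comp_id]
  | α_hom Y₁ Y₂ Y₃ =>
    obtain ⟨_, X₃, u, _, f₃, ⟨X₁, X₂, v, f₁, f₂, h₁, h₂, rfl⟩, h₃, rfl⟩ := hf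
    have e : LinearEquality.ten (can v ≫ LinearEquality.ten f₁ f₂) f₃ =
        can (v ⊗ₘ 𝟙 X₃) ≫ LinearEquality.ten (LinearEquality.ten f₁ f₂) f₃ := by
      rw [can_tensor, ← ten_comp, can_id, Category.id_comp]
    rw [Category.assoc, e, Category.assoc, ten_ten_can_assoc]
    exact ((h₁.ten (h₂.ten h₃)).can_comp _).can_comp _ |>.can_comp _
  | α_inv Y₁ Y₂ Y₃ =>
    obtain ⟨X₁, _, u, f₁, _, h₁, ⟨X₂, X₃, v, f₂, f₃, h₂, h₃, rfl⟩, rfl⟩ := hf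
    have e : LinearEquality.ten f₁ (can v ≫ LinearEquality.ten f₂ f₃) =
        can (𝟙 X₁ ⊗ₘ v) ≫ LinearEquality.ten f₁ (LinearEquality.ten f₂ f₃) := by
      rw [can_tensor, ← ten_comp, can_id, Category.id_comp]
    rw [Category.assoc, e, Category.assoc, ten_ten_can_assoc_inv]
    exact (((h₁.ten h₂).ten h₃).can_comp _).can_comp _ |>.can_comp _
  | l_hom Y =>
    obtain ⟨X₁, X₂, u, _, f₂, ⟨v, rfl⟩, h₂, rfl⟩ := hf
    have e : LinearEquality.ten (can v) f₂ =
        can (v ⊗ₘ 𝟙 X₂) ≫ LinearEquality.ten (𝟙 (Shape.formula s (𝟙_ _))) f₂ := by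
      rw [can_tensor, ← ten_comp, can_id, Category.id_comp, Category.comp_id]
    rw [Category.assoc, e, Category.assoc, ten_id_can_left]
    exact ((h₂.can_comp _).can_comp _).can_comp _
  | l_inv Y =>
    rw [comp_can_left_inv]
    exact (isNormal_id_unit.ten hf).can_comp _
  | ρ_hom Y =>
    obtain ⟨X₁, X₂, u, f₁, _, h₁, ⟨v, rfl⟩, rfl⟩ := hf
    have e : LinearEquality.ten f₁ (can v) =
        can (𝟙 X₁ ⊗ₘ v) ≫ LinearEquality.ten f₁ (𝟙 (Shape.formula s (𝟙_ _))) := by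
      rw [can_tensor, ← ten_comp, can_id, Category.id_comp, Category.comp_id]
    rw [Category.assoc, e, Category.assoc, ten_id_can_right]
    exact ((h₁.can_comp _).can_comp _).can_comp _
  | ρ_inv Y =>
    rw [comp_can_right_inv]
    exact (hf.ten isNormal_id_unit).can_comp _
  | comp v w ihv ihw =>
    rw [LinearEquality.can_comp, ← Category.assoc]
    exact ihw (ihv hf)
  | whiskerLeft Y v ih =>
    obtain ⟨X₁, X₂, u, f₁, f₂, h₁, h₂, rfl⟩ := hf
    rw [← id_tensorHom, can_tensor, Category.assoc, ← ten_comp, can_id, Category.comp_id]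
    exact (h₁.ten (ih h₂)).can_comp _
  | whiskerRight v Y ih =>
    obtain ⟨X₁, X₂, u, f₁, f₂, h₁, h₂, rfl⟩ := hf
    rw [← tensorHom_id, can_tensor, Category.assoc, ← ten_comp, can_id, Category.comp_id]
    exact ((ih h₁).ten h₂).can_comp _

theorem isNormal_can {X Y : Shape 𝒱} (u : X ⟶ Y) : IsNormal Y (can u : Arr s X Y) := by
  have h : IsNormal X (𝟙 (X.formula s)) := by
    clear u
    induction X with
    | of a => exact IsBlock.can (𝟙 _)
    | unit => exact ⟨𝟙 _, rfl⟩
    | tensor X Y ihX ihY =>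
      exact ⟨X, Y, 𝟙 _, 𝟙 _, 𝟙 _, ihX, ihY,
        ((Category.id_comp _).trans (id_tensorHom_id' _ _)).symm⟩
  rw [← Category.id_comp (can u)]
  exact h.comp_can u

/-- Cut elimination, by induction on `f`. If `f` is `r`, then `(rtσ)` leaves `g`. If `f` is
structural, the composite is a block at once, unless `g` is `r`, when `(rtδ)` applies. If `f` ends
in `t`, then `(tb)` hands the inner block of `f` to the induction hypothesis. -/
theorem IsBlock.ten_trans {X X' : Shape 𝒱} {x y z : 𝒱} (ht : s.HasT) {f : Arr s X (atom x y)}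
    {g : Arr s X' (atom y z)} (hf : IsBlock f) (hg : IsBlock g) :
    IsBlock (ten f g ≫ transArr ht x y z) := by
  -- Induction on `IsBlock` needs a variable as target atom, hence `a` with an equation and an
  -- `eqToHom`.
  have key : ∀ {X : Shape 𝒱} {a : 𝒱 × 𝒱} {f : Arr s X (.of a)}, IsBlock f →
      ∀ {x y : 𝒱} (h : a = (x, y)) {X' : Shape 𝒱} {z : 𝒱} {g : Arr s X' (atom y z)},
        IsBlock g → IsBlock (ten (f ≫ eqToHom (by rw [h])) g ≫ transArr ht x y z) := by
    intro X a f hf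
    induction hf with
    | refl u hr x =>
      intro x' y h X' z g hg
      cases h
      have e : ten ((LinearEquality.can u ≫ reflArr hr x) ≫ 𝟙 _) g =
          LinearEquality.can (u ⊗ₘ 𝟙 X') ≫ ten (𝟙 _) g ≫ ten (reflArr hr x) (𝟙 _) := by
        rw [can_tensor, ← ten_comp, ← ten_comp]
        simp
      rw [eqToHom_refl, e, Category.assoc, Category.assoc, refl_ten_trans, ten_id_can_left]
      exact (hg.can_comp _).can_comp _
    | @can X a u =>
      intro x y h X' z g hg
      cases h
      -- A block without source atoms can only be `r`.
      by_cases hX' : X'.atoms = []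
      · cases hg with
        | refl v hr x' =>
          have e : ten (LinearEquality.can u ≫ 𝟙 _) (LinearEquality.can v ≫ reflArr hr y) =
              LinearEquality.can (u ⊗ₘ v) ≫ ten (𝟙 _) (reflArr hr y) := by
            rw [can_tensor, ← ten_comp]
          rw [eqToHom_refl, e, Category.assoc, ten_refl_trans, ← LinearEquality.can_comp]
          exact .can _
        | can v => simpa [hX'] using atoms_eq v
        | trans _ _ _ v => simpa [hX'] using atoms_eq v
      · have e : ten (LinearEquality.can u ≫ 𝟙 _) g =
            LinearEquality.can (u ⊗ₘ 𝟙 X') ≫ ten (𝟙 _) g := by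
          rw [can_tensor, ← ten_comp, can_id, Category.id_comp]
        rw [eqToHom_refl, e, Category.assoc]
        exact .trans x y z _ hX' ht g hg
    | @trans X X' x y z u hX' ht f hf ih =>
      intro x' y' h W w g hg
      cases h
      have e : ten ((LinearEquality.can u ≫ ten (𝟙 _) f ≫ transArr ht x y z) ≫ 𝟙 _) g =
          LinearEquality.can (u ⊗ₘ 𝟙 W) ≫ ten (ten (𝟙 _) f) g ≫ ten (transArr ht x y z) (𝟙 _) := by
        rw [can_tensor, ← ten_comp, ← ten_comp]
        simp
      have e' : ten (𝟙 _) (ten f g) ≫ ten (𝟙 _) (transArr ht y z w) =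
          ten (𝟙 ((atom x y).formula s)) (ten f g ≫ transArr ht y z w) := by
        rw [← ten_comp, Category.id_comp]
      have hb : IsBlock (ten f g ≫ transArr ht y z w) := by
        simpa using ih rfl hg
      rw [eqToHom_refl, e, Category.assoc, Category.assoc, trans_assoc,
        ← Category.assoc (ten (ten _ f) g), ten_ten_can_assoc, Category.assoc,
        ← Category.assoc (ten _ (ten f g)), e', ← Category.assoc, ← LinearEquality.can_comp]
      -- The source of the new inner block contains the atoms of the old one, so it is not empty.
      exact .trans x y w _ (by simp [hX']) ht _ hb
  simpa using key hf rfl hg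

/-- The structural prefix of `g` is first absorbed into `f`, whose target then has the form that the
rest of `g` expects. So `f` splits along the factors of `g`, and the composition is done factorwise;
a `t` at the end is handled by `IsBlock.ten_trans`. -/
theorem IsNormal.comp {X Y Z : Shape 𝒱} {f : Arr s X Y} {g : Arr s Y Z} (hf : IsNormal Y f)
    (hg : IsNormal Z g) : IsNormal Z (f ≫ g) := by
  induction Z generalizing X Y with
  | of a =>
    change IsBlock g at hg
    change IsBlock (f ≫ g)
    induction hg generalizing X with
    | refl u hr x =>
      -- A normal arrow into the unit is structural.
      obtain ⟨v, hv⟩ := hf.comp_can u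
      rw [← Category.assoc, hv]
      exact .refl _ hr x
    | can u => exact hf.comp_can u
    | trans x y z u hX' ht g _ ih =>
      obtain ⟨X₁, X₂, v, f₁, f₂, h₁, h₂, h⟩ := hf.comp_can u
      rw [← Category.assoc, h, Category.assoc, ← Category.assoc (LinearEquality.ten f₁ f₂),
        ← ten_comp, Category.comp_id]
      exact (IsBlock.ten_trans ht h₁ (ih h₂)).can_comp v
  | unit =>
    obtain ⟨u, rfl⟩ := hg
    exact hf.comp_can u
  | tensor Z₁ Z₂ ih₁ ih₂ =>
    obtain ⟨Y₁, Y₂, u, g₁, g₂, hg₁, hg₂, rfl⟩ := hg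
    obtain ⟨X₁, X₂, v, f₁, f₂, hf₁, hf₂, h⟩ := hf.comp_can u
    rw [← Category.assoc, h, Category.assoc, ← ten_comp]
    exact (IsNormal.ten (ih₁ hf₁ hg₁) (ih₂ hf₂ hg₂)).can_comp v

theorem isNormal_refl (hr : s.HasR) (x : 𝒱) : IsNormal (atom x x) (reflArr hr x) := by
  have h : IsBlock (can (𝟙 _) ≫ reflArr hr x) := .refl _ hr x
  rwa [can_id, Category.id_comp] at h

/-- The case of two identities in `IsBlock.ten_trans`. -/
theorem isNormal_trans (ht : s.HasT) (x y z : 𝒱) : IsNormal (atom x z) (transArr ht x y z) := by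
  have h := IsBlock.ten_trans ht (isNormal_can (s := s) (𝟙 (atom x y)))
    (isNormal_can (𝟙 (atom y z)))
  rwa [← can_tensor, id_tensorHom_id, can_id, Category.id_comp] at h

/-! ### Every arrow has a normal form -/

/-- The shape of a formula. -/
def Formula.shape : Formula 𝒱 → Shape 𝒱
  | .leq x y => atom x y
  | .top => 𝟙_ _
  | .and A B => A.shape ⊗ B.shape

/-- A formula is recovered from its shape. -/
def shapeIso (s : Variant) : (A : Formula 𝒱) → (A.shape.formula s ≅ ⟨A⟩)
  | .leq _ _ => Iso.refl _
  | .top => Iso.refl _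
  | .and A B => tensorIso (shapeIso s A) (shapeIso s B)

/-- An arrow of `M_≤`, read as an arrow between shapes. -/
def onShapes {A B : Formula 𝒱} (f : (⟨A⟩ : M 𝒱 s) ⟶ ⟨B⟩) : Arr s A.shape B.shape :=
  (shapeIso s A).hom ≫ f ≫ (shapeIso s B).inv

/-- In this form, computing `onShapes` of a structural generator amounts to a naturality square for
`shapeIso`. -/
theorem onShapes_eq_iff {A B : Formula 𝒱} {f : (⟨A⟩ : M 𝒱 s) ⟶ ⟨B⟩} {g : Arr s A.shape B.shape} :
    onShapes f = g ↔ (shapeIso s A).hom ≫ f = g ≫ (shapeIso s B).hom := by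
  rw [onShapes, ← Category.assoc, Iso.comp_inv_eq]

theorem onShapes_injective {A B : Formula 𝒱} :
    Function.Injective (onShapes : ((⟨A⟩ : M 𝒱 s) ⟶ ⟨B⟩) → _) := by
  intro f g h
  rw [onShapes_eq_iff, onShapes, Category.assoc, Category.assoc, Iso.inv_hom_id,
    Category.comp_id] at h
  exact (cancel_epi _).1 h

theorem onShapes_comp {A B C : Formula 𝒱} (f : (⟨A⟩ : M 𝒱 s) ⟶ ⟨B⟩) (g : (⟨B⟩ : M 𝒱 s) ⟶ ⟨C⟩) :
    onShapes (f ≫ g) = onShapes f ≫ onShapes g := by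
  simp [onShapes]

theorem onShapes_tensor {A B C D : Formula 𝒱} (f : (⟨A⟩ : M 𝒱 s) ⟶ ⟨B⟩)
    (g : (⟨C⟩ : M 𝒱 s) ⟶ ⟨D⟩) :
    onShapes (A := .and A C) (B := .and B D) (f ⊗ₘ g) = ten (onShapes f) (onShapes g) := by
  change ((shapeIso s A).hom ⊗ₘ (shapeIso s C).hom) ≫ (f ⊗ₘ g) ≫
    ((shapeIso s B).inv ⊗ₘ (shapeIso s D).inv) = _ ⊗ₘ _
  rw [tensorHom_comp_tensorHom', tensorHom_comp_tensorHom']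
  rfl

/-- Structural generators become arrows `can`, while `r` and `t` are normal themselves; the two
term-forming operations preserve normality. -/
theorem isNormal_onShapes {A B : Formula 𝒱} (f : ArrowTerm 𝒱 s A B) :
    IsNormal B.shape (onShapes f.toHom) := by
  induction f with
  | one A =>
    have h : onShapes (ArrowTerm.one A : ArrowTerm 𝒱 s A A).toHom = can (𝟙 A.shape) :=
      onShapes_eq_iff.2 ((Category.comp_id _).trans (Category.id_comp _).symm)
    exact h ▸ isNormal_can _
  | bTo A B C =>
    have h : onShapes (ArrowTerm.bTo A B C : ArrowTerm 𝒱 s _ _).toHom =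
        can (α_ A.shape B.shape C.shape).inv :=
      onShapes_eq_iff.2 (associator_inv_naturality _ _ _)
    exact h ▸ isNormal_can _
  | bFrom A B C =>
    have h : onShapes (ArrowTerm.bFrom A B C : ArrowTerm 𝒱 s _ _).toHom =
        can (α_ A.shape B.shape C.shape).hom :=
      onShapes_eq_iff.2 (associator_naturality _ _ _)
    exact h ▸ isNormal_can _
  | dTo A =>
    have h : onShapes (ArrowTerm.dTo A : ArrowTerm 𝒱 s _ _).toHom = can (ρ_ A.shape).hom :=
      onShapes_eq_iff.2 (Eq.trans (congrArg (· ≫ _) (tensorHom_id _ _))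
        (rightUnitor_naturality _))
    exact h ▸ isNormal_can _
  | dFrom A =>
    have h : onShapes (ArrowTerm.dFrom A : ArrowTerm 𝒱 s _ _).toHom = can (ρ_ A.shape).inv :=
      onShapes_eq_iff.2 (Eq.trans (rightUnitor_inv_naturality _)
        (congrArg (_ ≫ ·) (tensorHom_id _ _).symm))
    exact h ▸ isNormal_can _
  | sTo A =>
    have h : onShapes (ArrowTerm.sTo A : ArrowTerm 𝒱 s _ _).toHom = can (λ_ A.shape).hom :=
      onShapes_eq_iff.2 (Eq.trans (congrArg (· ≫ _) (id_tensorHom _ _))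
        (leftUnitor_naturality _))
    exact h ▸ isNormal_can _
  | sFrom A =>
    have h : onShapes (ArrowTerm.sFrom A : ArrowTerm 𝒱 s _ _).toHom = can (λ_ A.shape).inv :=
      onShapes_eq_iff.2 (Eq.trans (leftUnitor_inv_naturality _)
        (congrArg (_ ≫ ·) (id_tensorHom _ _).symm))
    exact h ▸ isNormal_can _
  | r hr x =>
    have h : onShapes (ArrowTerm.r hr x).toHom = reflArr hr x :=
      onShapes_eq_iff.2 ((Category.id_comp _).trans (Category.comp_id _).symm)
    exact h ▸ isNormal_refl hr x
  | t ht x y z =>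
    have h : onShapes (ArrowTerm.t ht x y z).toHom = transArr ht x y z :=
      onShapes_eq_iff.2 (Eq.trans (congrArg (· ≫ _) (id_tensorHom_id' _ _))
        ((Category.id_comp _).trans (Category.comp_id _).symm))
    exact h ▸ isNormal_trans ht x y z
  | wedge f g ihf ihg =>
    have h := ihf.ten ihg
    rw [← onShapes_tensor] at h
    exact h
  | comp g f ihg ihf =>
    have h := ihf.comp ihg
    rw [← onShapes_comp] at h
    exact h

/-! ### Normal forms are determined by their diagrams -/

namespace Br

variable {n m n' m' : ℕ}

theorem tensor_rel_leftPt {f : Diagram n m} {g : Diagram n' m'} {u v : Fin n ⊕ Fin m} :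
    (f.tensor g).1 (leftPt n m n' m' u) (leftPt n m n' m' v) ↔ f.1 u v := by
  refine ⟨?_, tensor_left f g⟩
  rintro (⟨_, _, h, hu, hv⟩ | ⟨_, _, h, hu, hv⟩)
  · rwa [leftPt_injective hu, leftPt_injective hv]
  · exact absurd hu (leftPt_ne_rightPt _ _)

theorem tensor_rel_rightPt {f : Diagram n m} {g : Diagram n' m'} {u v : Fin n' ⊕ Fin m'} :
    (f.tensor g).1 (rightPt n m n' m' u) (rightPt n m n' m' v) ↔ g.1 u v := by
  refine ⟨?_, tensor_right f g⟩
  rintro (⟨_, _, h, hu, hv⟩ | ⟨_, _, h, hu, hv⟩)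
  · exact absurd hu.symm (leftPt_ne_rightPt _ _)
  · rwa [rightPt_injective hu, rightPt_injective hv]

theorem not_tensor_rel {f : Diagram n m} {g : Diagram n' m'} {u : Fin n ⊕ Fin m}
    {v : Fin n' ⊕ Fin m'} : ¬ (f.tensor g).1 (leftPt n m n' m' u) (rightPt n m n' m' v) := by
  rintro (⟨_, _, -, -, hv⟩ | ⟨_, _, -, hu, -⟩)
  · exact leftPt_ne_rightPt _ _ hv.symm
  · exact leftPt_ne_rightPt _ _ hu

theorem tensor_injective {f f' : Diagram n m} {g g' : Diagram n' m'}
    (h : f.tensor g = f'.tensor g') : f = f' ∧ g = g' :=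
  ⟨Diagram.ext_of_le fun {_ _} huv =>
      tensor_rel_leftPt.1 (h ▸ tensor_rel_leftPt.2 huv : (f'.tensor g').1 _ _),
    Diagram.ext_of_le fun {_ _} huv =>
      tensor_rel_rightPt.1 (h ▸ tensor_rel_rightPt.2 huv : (f'.tensor g').1 _ _)⟩

/-- The first point of the source, if there is one, is joined with a point of the target. -/
def FirstThrough (f : Diagram n m) : Prop :=
  ∀ i : Fin n, i.1 = 0 → ∃ j : Fin m, f.1 (Sum.inl i) (Sum.inr j)

theorem FirstThrough.lines_comp {k : ℕ} (h : k = n) {f : Diagram n m} (hf : FirstThrough f) :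
    FirstThrough ((lines h).comp f) := by
  intro i hi
  obtain ⟨j, hj⟩ := hf (Fin.cast h i) hi
  exact ⟨j, comp_rel_left _ _ _ _ _ (lines_rel_left h i) hj⟩

theorem FirstThrough.tensor {f : Diagram n m} {g : Diagram n' m'} (hf : FirstThrough f)
    (hg : FirstThrough g) : FirstThrough (f.tensor g) := by
  intro i hi
  induction i using Fin.addCases with
  | left i =>
    obtain ⟨j, hj⟩ := hf i hi
    exact ⟨_, tensor_left f g hj⟩
  | right i =>
    rw [Fin.val_natAdd] at hi
    obtain ⟨j, hj⟩ := hg i (by omega)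
    exact ⟨_, tensor_right f g hj⟩

/-- A diagram splits as a horizontal composite in one place only, once the target points are
distributed. -/
theorem source_le_of_tensor_eq {N n₁ n₂ k₁ k₂ m₁ m₂ : ℕ} (e : N = n₁ + n₂) (e' : N = k₁ + k₂)
    {f₁ : Diagram n₁ m₁} {f₂ : Diagram n₂ m₂} {g₁ : Diagram k₁ m₁} {g₂ : Diagram k₂ m₂}
    (h₂ : FirstThrough f₂)
    (h : (lines e).comp (f₁.tensor f₂) = (lines e').comp (g₁.tensor g₂)) : k₁ ≤ n₁ := by
  by_contra! hlt
  -- If `n₁ < k₁`, the source point `n₁` is the first one of `f₂`, hence is joined with a target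
  -- point on the right. On the other side it belongs to `g₁`, which reaches only target points on
  -- the left.
  obtain ⟨j, hj⟩ := h₂ ⟨0, by omega⟩ rfl
  have h' : ((lines e).comp (f₁.tensor f₂)).1 (Sum.inl ⟨n₁, by omega⟩)
      (Sum.inr (Fin.natAdd m₁ j)) :=
    comp_rel_left _ _ _ _ _ (lines_rel_left e _) (tensor_right f₁ f₂ hj)
  rw [h, Br.lines_comp] at h'
  exact not_tensor_rel (f := g₁) (g := g₂) (u := Sum.inl ⟨n₁, hlt⟩) (v := Sum.inr j) h'

end Br

/-- The diagram of an arrow between shapes. -/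
def diagram {X Y : Shape 𝒱} (f : Arr s X Y) : Br.Diagram (occ s X) (occ s Y) :=
  (G 𝒱 s).map f

theorem diagram_comp {X Y Z : Shape 𝒱} (f : Arr s X Y) (g : Arr s Y Z) :
    diagram (f ≫ g) = (diagram f).comp (diagram g) :=
  (G 𝒱 s).map_comp f g

theorem diagram_ten {X Y X' Y' : Shape 𝒱} (f : Arr s X Y) (g : Arr s X' Y') :
    diagram (ten f g) = (diagram f).tensor (diagram g) := by
  induction f using Quotient.inductionOn
  induction g using Quotient.inductionOn
  rfl

theorem diagram_can {X Y : Shape 𝒱} (u : X ⟶ Y) (h : occ s X = occ s Y) :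
    diagram (can u : Arr s X Y) = Br.lines h := by
  induction u using FreeMonoidalCategory.Hom.inductionOn with
  | id X => rfl
  | α_hom X Y Z => rfl
  | α_inv X Y Z => rfl
  | l_hom X => rfl
  | l_inv X => rfl
  | ρ_hom X => rfl
  | ρ_inv X => rfl
  | @comp X Y Z u v ihu ihv =>
    have hu : occ s X = occ s Y := by rw [occ_eq, occ_eq, atoms_eq u]
    rw [can_comp, diagram_comp, ihu hu, ihv (hu.symm.trans h), Br.lines_comp_lines]
  | whiskerLeft X u ih =>
    rw [← id_tensorHom, can_tensor, diagram_ten, ih (by rw [occ_eq, occ_eq, atoms_eq u])]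
    exact Br.lines_tensor_lines rfl _
  | whiskerRight u X ih =>
    rw [← tensorHom_id, can_tensor, diagram_ten, ih (by rw [occ_eq, occ_eq, atoms_eq u])]
    exact Br.lines_tensor_lines _ rfl

theorem diagram_can_comp {X Y Z : Shape 𝒱} (u : X ⟶ Y) (f : Arr s Y Z) :
    diagram (can u ≫ f) =
      (Br.lines (by rw [occ_eq, occ_eq, atoms_eq u])).comp (diagram f) := by
  rw [diagram_comp, diagram_can]

/-- With nesting to the right, the first atom passes through an identity to the outermost `t`, which
joins its first source point with its first target point. For `r` there is no source point. -/
theorem IsBlock.diagram_rel {X : Shape 𝒱} {a : 𝒱 × 𝒱} {f : Arr s X (.of a)} (hf : IsBlock f)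
    (i : Fin (occ s X)) (hi : i.1 = 0) : (diagram f).1 (Sum.inl i) (Sum.inr (0 : Fin 2)) := by
  induction hf with
  | @refl X u hr x =>
    have h : occ s X = 0 := by rw [occ_eq, atoms_eq u]; rfl
    exact absurd i.2 (by omega)
  | @can X a u =>
    rw [diagram_can u (by rw [occ_eq, occ_eq, atoms_eq u])]
    have h : occ s X = 2 := by rw [occ_eq, atoms_eq u]; rfl
    exact show Fin.cast h i = (0 : Fin 2) by rw [Fin.ext_iff]; exact hi
  | @trans X X' x y z u hX' ht f hf ih =>
    rw [diagram_can_comp, diagram_comp, diagram_ten]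
    refine Br.comp_rel_left _ _ i _ _ (Br.lines_rel_left _ i) ?_
    refine Br.comp_rel_left _ (diagram (transArr ht x y z)) _ (0 : Fin (2 + 2)) _ ?_ rfl
    have h : (diagram (𝟙 ((atom x y).formula s))).1 (Sum.inl (0 : Fin 2)) (Sum.inr (0 : Fin 2)) :=
      Br.lines_rel_left rfl _
    have h' := Br.tensor_left _ (diagram f) h
    have hX : occ s X = 2 + occ s X' := by
      rw [occ_eq, occ_eq, atoms_eq u]
      simp only [atoms_tensor, atoms_of, List.length_append, List.length_singleton]
      ring
    have e : Fin.cast hX i = Fin.castAdd (occ s X') (0 : Fin 2) := by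
      rw [Fin.ext_iff]; exact hi
    -- The index in the goal is a cast of `i`; abstracting it as `k` allows the substitution.
    have key : ∀ k, k = Fin.castAdd (occ s X') (0 : Fin 2) →
        ((diagram (𝟙 ((atom x y).formula s))).tensor (diagram f)).1 (Sum.inl k)
          (Sum.inr (Fin.castAdd 2 (0 : Fin 2))) := by
      rintro _ rfl
      exact h'
    exact key _ e

/-- Both factors of a tensor product are needed, since the first may have an empty source. -/
theorem IsNormal.firstThrough {X Y : Shape 𝒱} {f : Arr s X Y} (hf : IsNormal Y f) :
    Br.FirstThrough (diagram f) := by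
  induction Y generalizing X with
  | of a => exact fun i hi => ⟨(0 : Fin 2), IsBlock.diagram_rel hf i hi⟩
  | unit =>
    obtain ⟨u, rfl⟩ := hf
    intro i
    have h : occ s X = 0 := by rw [occ_eq, atoms_eq u]; rfl
    exact absurd i.2 (by omega)
  | tensor Y₁ Y₂ ih₁ ih₂ =>
    obtain ⟨X₁, X₂, u, f₁, f₂, h₁, h₂, rfl⟩ := hf
    rw [diagram_can_comp, diagram_ten]
    exact Br.FirstThrough.lines_comp _ ((ih₁ h₁).tensor (ih₂ h₂))

/-- No diagram is needed: a source with no atom, one atom or more atoms forces the three cases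
respectively. In the last one, the first atom gives the middle variable and the remaining atoms give
the source of the inner block. -/
theorem IsBlock.eq {X : Shape 𝒱} {a : 𝒱 × 𝒱} {f g : Arr s X (.of a)} (hf : IsBlock f)
    (hg : IsBlock g) : f = g := by
  have key : ∀ {X : Shape 𝒱} {a : 𝒱 × 𝒱} {f : Arr s X (.of a)}, IsBlock f →
      ∀ {b : 𝒱 × 𝒱} {g : Arr s X (.of b)}, IsBlock g → ∀ h : a = b,
        f ≫ eqToHom (by rw [h]) = g := by
    intro X a f hf
    induction hf with
    | refl u hr x =>
      have hX := atoms_eq u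
      intro b g hg h
      cases hg with
      | refl v => cases h; rw [eqToHom_refl, Category.comp_id, can_eq u v]
      | can v => simpa [hX] using atoms_eq v
      | trans _ _ _ v => simpa [hX] using atoms_eq v
    | can u =>
      have hX := atoms_eq u
      intro b g hg h
      cases hg with
      | refl v => simpa [hX] using atoms_eq v
      | can v => cases h; rw [eqToHom_refl, Category.comp_id, can_eq u v]
      | trans _ _ _ v hX' =>
        have := atoms_eq v
        simp_all
    | @trans X X' x y z u hX' ht f hf ih =>
      have hX := atoms_eq u
      intro b g hg h
      cases hg with
      | refl v => simpa [hX] using atoms_eq v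
      | can v =>
        have := atoms_eq v
        simp_all
      | @trans _ W x' y' z' v hW _ g hg =>
        have hv := atoms_eq v
        rw [hX] at hv
        cases h
        -- The inner sources have the same atoms but may be bracketed differently, so `g` is carried
        -- over along a structural arrow before the induction hypothesis is applied.
        obtain ⟨hy, hW⟩ : y = y' ∧ W.atoms = X'.atoms := by simp_all
        cases hy
        obtain ⟨w⟩ := nonempty_hom hW
        have e := ih (hg.can_comp (Groupoid.inv w)) rfl
        rw [eqToHom_refl, Category.comp_id] at e
        have e' : ten (𝟙 ((atom x y).formula s)) (LinearEquality.can (Groupoid.inv w) ≫ g) =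
            LinearEquality.can (𝟙 _ ⊗ₘ Groupoid.inv w) ≫ ten (𝟙 _) g := by
          rw [can_tensor, ← ten_comp, can_id, Category.id_comp]
        rw [eqToHom_refl, Category.comp_id, e, e', Category.assoc,
          ← Category.assoc (LinearEquality.can u), ← LinearEquality.can_comp, can_eq (u ≫ _) v]
  simpa using key hf hg rfl

/-- The diagram serves to find the cut of the source between the two factors. Once the cuts agree,
both arrows can be written over the same split source, and their diagrams agree factorwise. -/
theorem IsNormal.eq_of_diagram_eq {X Y : Shape 𝒱} {f g : Arr s X Y} (hf : IsNormal Y f)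
    (hg : IsNormal Y g) (h : diagram f = diagram g) : f = g := by
  induction Y generalizing X with
  | of a => exact IsBlock.eq hf hg
  | unit =>
    obtain ⟨u, rfl⟩ := hf
    obtain ⟨v, rfl⟩ := hg
    exact can_eq u v
  | tensor Y₁ Y₂ ih₁ ih₂ =>
    obtain ⟨X₁, X₂, u, f₁, f₂, hf₁, hf₂, rfl⟩ := hf
    obtain ⟨W₁, W₂, v, g₁, g₂, hg₁, hg₂, rfl⟩ := hg
    have h' := h
    rw [diagram_can_comp, diagram_can_comp, diagram_ten, diagram_ten] at h'
    have hocc : occ s W₁ = occ s X₁ :=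
      le_antisymm (Br.source_le_of_tensor_eq _ _ hf₂.firstThrough h')
        (Br.source_le_of_tensor_eq _ _ hg₂.firstThrough h'.symm)
    have hatoms : W₁.atoms ++ W₂.atoms = X₁.atoms ++ X₂.atoms := by
      rw [← atoms_tensor, ← atoms_tensor, ← atoms_eq u, ← atoms_eq v]
    rw [occ_eq, occ_eq] at hocc
    -- Equal numbers of variable occurrences mean equally long first parts.
    obtain ⟨e₁, e₂⟩ := List.append_inj hatoms (by omega)
    obtain ⟨w₁⟩ := nonempty_hom e₁
    obtain ⟨w₂⟩ := nonempty_hom e₂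
    have e : can u ≫ LinearEquality.ten f₁ f₂ =
        can v ≫ LinearEquality.ten (can w₁ ≫ f₁) (can w₂ ≫ f₂) := by
      rw [ten_comp, ← can_tensor, ← Category.assoc, ← LinearEquality.can_comp,
        can_eq u (v ≫ (w₁ ⊗ₘ w₂))]
    rw [e] at h ⊢
    -- Composing with the inverse of `can v` removes the common structural prefix.
    have h'' := congrArg (fun D => (diagram (can (Groupoid.inv v) : Arr s _ _)).comp D) h
    simp only [← diagram_comp] at h''
    rw [← Category.assoc, ← Category.assoc, can_inv_comp, Category.id_comp, Category.id_comp,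
      diagram_ten, diagram_ten] at h''
    obtain ⟨d₁, d₂⟩ := Br.tensor_injective h''
    rw [ih₁ (hf₁.can_comp w₁) hg₁ d₁, ih₂ (hf₂.can_comp w₂) hg₂ d₂]

/-- Arrow terms with the same diagram are equal in `M_≤` and in its two variants. -/
theorem faithful_G (𝒱 : Type u) (s : Variant) : (G 𝒱 s).Faithful where
  map_injective := by
    rintro ⟨A⟩ ⟨B⟩ f g h
    have hn : ∀ f : (⟨A⟩ : M 𝒱 s) ⟶ ⟨B⟩, IsNormal B.shape (onShapes f) := by
      rintro ⟨f⟩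
      exact isNormal_onShapes f
    -- Passing to shapes composes `f` and `g` with the same isomorphisms, so their diagrams stay
    -- equal.
    apply onShapes_injective
    apply (hn f).eq_of_diagram_eq (hn g)
    change (G 𝒱 s).map _ = (G 𝒱 s).map _
    rw [onShapes, onShapes, Functor.map_comp, Functor.map_comp, Functor.map_comp,
      Functor.map_comp, h]

end LinearEquality

/-- Coherence of `M_≤`: the functor `G` to `Br` is faithful, i.e. two arrows with the same source
and target are equal if and only if they have the same diagram. The same holds in the absence of the
arrows `r_x`, and in the absence of the arrows `t_{x,y,z}`. -/
theorem mainTheorem1 (𝒱 : Type*) :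
    ((LinearEquality.G 𝒱 .full).Faithful ∧
      ∀ (A B : LinearEquality.Formula 𝒱) (f g : LinearEquality.ArrowTerm 𝒱 .full A B),
        f.toHom = g.toHom ↔
          (LinearEquality.G 𝒱 .full).map f.toHom = (LinearEquality.G 𝒱 .full).map g.toHom) ∧
    (LinearEquality.G 𝒱 .withoutR).Faithful ∧
    (LinearEquality.G 𝒱 .withoutT).Faithful :=
  ⟨⟨LinearEquality.faithful_G 𝒱 _, fun _ _ _ _ =>
      ⟨fun h => by rw [h], fun h => (LinearEquality.faithful_G 𝒱 _).map_injective h⟩⟩,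
    LinearEquality.faithful_G 𝒱 _, LinearEquality.faithful_G 𝒱 _⟩
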